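/- An episodic MDP on a finite state space $\mathcal S$ and a finite action space $\mathcal A$ consists of a reward function $R$, transition probabilities $P(\cdot\mid s,a)$, an initial distribution $\mu_0$ and an episode length $H$. Its minimum transition probability is $p_{\min}=\min\{P(s'\mid s,a): P(s'\mid s,a)>0\}$, and its diameter $D$ is the maximum over $s\in\mathcal S$ of the least $T$ for which there is a path $s_0,a_0,s_1,\dots,s_T=s$ with $\mu_0(s_0)>0$ and $P(s_{t+1}\mid s_t,a_t)>0$ for all $t$. A Q-learner $L$ keeps a Q-table $Q_t\in\mathbb R^{\mathcal S\times\mathcal A}$. In state $s$ it plays a maximizer $a^*$ of $Q_t(s,\cdot)$ (ties broken by a fixed rule) with probability $1-\epsilon$ and a uniformly random element of $\mathcal A\setminus\{a^*\}$ with probability $\epsilon$, where $\epsilon\in[0,1]$. It updates $Q_{t+1}=f(Q_t,(s_t,a_t,r_t,s_{t+1}))$, where $f$ changes only the $(s_t,a_t)$ entry and, for all $Q_t,s_t,a_t,s_{t+1}$, there are rewards $r_t$ that make the rank of $a_t$ in $Q_{t+1}(s_t,\cdot)$ strictly first, strictly last, or unchanged. A Level 4 teacher, who knows everything that has happened so far,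 chooses only the rewards $r_t$ (after seeing $s_t,a_t,s_{t+1}$). Every $H$ steps the state is redrawn from $\mu_0$, and otherwise $s_{t+1}\sim P(\cdot\mid s_t,a_t)$. Teaching ends at the first time $T$ at which $\pi^\dagger(s)$ is the unique maximizer of $Q_T(s,\cdot)$ for every $s$. $\mathrm{METaL}(M,L,Q_0,\pi^\dagger)\in[0,\infty]$ is the infimum of $\mathbb E[T]$ over all Level 4 teachers, and for a family $\mathcal M$ of MDPs, $\mathrm{TDim}(L,\mathcal M)=\sup_{\pi^\dagger,\,Q_0,\,M\in\mathcal M}\mathrm{METaL}(M,L,Q_0,\pi^\dagger)$. Theorem. There is an absolute constant $c>0$ such that the following holds for all $\mathcal S$ and $\mathcal A$ with $|\mathcal S|=S$ and $|\mathcal A|=A\ge 2$, every such learner $L$, all integers $H\ge D\ge 0$ with $S\ge D+2$, and every $p_{\min}$ for which the family $\mathcal M$ of all MDPs on $\mathcal S,\mathcal A$ with episode length $H$, diameter $D$ and minimum transition probability $p_{\min}$ is nonempty (with $1/0=\infty$): $$\mathrm{TDim}(L,\mathcal M)\ \ge\ c\,(S-D)\,A\,H\left(\frac{1}{p_{\min}(1-\epsilon)}\right)^{D}.$$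 Moreover, if $D\ge 1$, $S\le 2^D+1$ and $\epsilon\log_2(S-D)\le(1-\epsilon)(A-1)$ (for instance, if $\epsilon=0$), the same lower bound holds for $\mathrm{TDim}(L,\mathcal M_1)$, where $\mathcal M_1\subseteq\mathcal M$ consists of the MDPs in $\mathcal M$ whose initial state is deterministic. -/

import Mathlib

open scoped ENNReal NNReal

noncomputable section

namespace RLTeaching

/-- Q-tables: a real value for every state-action pair. -/
abbrev QTable (S A : Type) : Type := S → A → ℝ

/-- An experience `(s_t, a_t, r_t, s_{t+1})`. -/
structure Experience (S A : Type) where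
  state : S
  action : A
  reward : ℝ
  next : S

/-- An episodic Markov decision process: reward function, transition probabilities, initial state
distribution and episode length. -/
structure MDP (S A : Type) where
  R : S → A → ℝ
  P : S → A → PMF S
  μ₀ : PMF S
  H : ℕ

namespace MDP

variable {S A : Type}

/-- The minimum transition probability: the least of the nonzero numbers `P(s' | s, a)`. -/
def pMin (M : MDP S A) : ℝ≥0∞ :=
  ⨅ (s : S) (a : A) (s' : S) (_ : 0 < M.P s a s'), M.P s a s'

/-- `M.ReachIn T s`: there is a path `s_0, a_0, s_1, a_1, …, s_T = s` with `μ₀ s_0 > 0` and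
`P(s_{t+1} | s_t, a_t) > 0` for all `t`. -/
def ReachIn (M : MDP S A) : ℕ → S → Prop
  | 0, s => 0 < M.μ₀ s
  | T + 1, s => ∃ (s' : S) (a : A), M.ReachIn T s' ∧ 0 < M.P s' a s

/-- The diameter: the length of a shortest path to the hardest-to-get-to state (`⊤` if some state
cannot be reached). -/
def diam (M : MDP S A) : ℕ∞ :=
  ⨆ s : S, ⨅ (T : ℕ) (_ : M.ReachIn T s), (T : ℕ∞)

end MDP

/-- The family of all MDPs on the given state and action spaces with episode length `H`,
diameter `D` and minimum transition probability `p`. -/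
def mdpFamily (S A : Type) (H D : ℕ) (p : ℝ≥0∞) : Set (MDP S A) :=
  {M | M.H = H ∧ M.diam = (D : ℕ∞) ∧ M.pMin = p}

/-- The family of Q-learning agents: an `ε`-greedy behavior policy (`greedy` is the agent's
choice of a maximizing action, with an arbitrary rule for breaking ties), and a controllable
update `f` that modifies only the visited entry of the Q-table. -/
structure Learner (S A : Type) where
  ε : ℝ
  ε_nonneg : 0 ≤ ε
  ε_le_one : ε ≤ 1
  greedy : QTable S A → S → A
  greedy_max : ∀ (Q : QTable S A) (s : S) (b : A), Q s b ≤ Q s (greedy Q s)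
  f : QTable S A → Experience S A → QTable S A
  f_local : ∀ (Q : QTable S A) (e : Experience S A) (s : S) (a : A),
    ¬ (s = e.state ∧ a = e.action) → f Q e s a = Q s a
  can_promote : ∀ (Q : QTable S A) (s : S) (a : A) (s' : S), ∃ r : ℝ,
    ∀ b : A, b ≠ a → f Q ⟨s, a, r, s'⟩ s b < f Q ⟨s, a, r, s'⟩ s a
  can_demote : ∀ (Q : QTable S A) (s : S) (a : A) (s' : S), ∃ r : ℝ,
    ∀ b : A, b ≠ a → f Q ⟨s, a, r, s'⟩ s a < f Q ⟨s, a, r, s'⟩ s b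
  can_maintain : ∀ (Q : QTable S A) (s : S) (a : A) (s' : S), ∃ r : ℝ,
    ∀ b : A, (f Q ⟨s, a, r, s'⟩ s b < f Q ⟨s, a, r, s'⟩ s a ↔ Q s b < Q s a) ∧
      (f Q ⟨s, a, r, s'⟩ s a < f Q ⟨s, a, r, s'⟩ s b ↔ Q s a < Q s b)

namespace Learner

variable {S A : Type} [Fintype A] [Nontrivial A]

open Classical in
/-- Probability of action `a` under the behavior policy: `1 - ε` for the greedy action, and
`ε / (|A| - 1)` for each of the others. -/
def behaviorProb (L : Learner S A) (Q : QTable S A) (s : S) (a : A) : ℝ :=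
  if a = L.greedy Q s then 1 - L.ε else L.ε / ((Fintype.card A : ℝ) - 1)

lemma card_sub_one_pos : (0 : ℝ) < (Fintype.card A : ℝ) - 1 := by
  have h : 1 < Fintype.card A := Fintype.one_lt_card
  have h' : (1 : ℝ) < (Fintype.card A : ℝ) := by exact_mod_cast h
  linarith

lemma behaviorProb_nonneg (L : Learner S A) (Q : QTable S A) (s : S) (a : A) :
    0 ≤ L.behaviorProb Q s a := by
  unfold behaviorProb
  split_ifs
  · linarith [L.ε_le_one]
  · exact div_nonneg L.ε_nonneg (card_sub_one_pos (A := A)).le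

lemma sum_behaviorProb (L : Learner S A) (Q : QTable S A) (s : S) :
    ∑ a, L.behaviorProb Q s a = 1 := by
  classical
  have hpos := (card_sub_one_pos (A := A)).ne'
  have hc : 1 ≤ Fintype.card A := Fintype.one_lt_card.le
  rw [← Finset.add_sum_erase Finset.univ _ (Finset.mem_univ (L.greedy Q s))]
  have h1 : L.behaviorProb Q s (L.greedy Q s) = 1 - L.ε := by simp [behaviorProb]
  have h2 : ∑ a ∈ Finset.univ.erase (L.greedy Q s), L.behaviorProb Q s a
      = ∑ _a ∈ Finset.univ.erase (L.greedy Q s), L.ε / ((Fintype.card A : ℝ) - 1) := by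
    refine Finset.sum_congr rfl fun a ha => ?_
    simp [behaviorProb, Finset.ne_of_mem_erase ha]
  rw [h1, h2, Finset.sum_const, Finset.card_erase_of_mem (Finset.mem_univ _), Finset.card_univ,
    nsmul_eq_mul, Nat.cast_sub hc, Nat.cast_one]
  field_simp
  ring

/-- The `ε`-greedy behavior policy at state `s` with Q-table `Q`. -/
def behavior (L : Learner S A) (Q : QTable S A) (s : S) : PMF A :=
  PMF.ofFintype (fun a => ENNReal.ofReal (L.behaviorProb Q s a)) (by
    rw [← ENNReal.ofReal_sum_of_nonneg (fun a _ => L.behaviorProb_nonneg Q s a),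
      L.sum_behaviorProb, ENNReal.ofReal_one])

end Learner

/-- The Q-table after a history of experiences (most recent experience first). -/
def Learner.table {S A : Type} (L : Learner S A) (Q₀ : QTable S A) :
    List (Experience S A) → QTable S A
  | [] => Q₀
  | e :: h => L.f (L.table Q₀ h) e

/-- The Q-table induces the target policy: in every state the target action is the unique
maximizer. -/
def Taught {S A : Type} (target : S → A) (Q : QTable S A) : Prop :=
  ∀ (s : S) (b : A), b ≠ target s → Q s b < Q s (target s)

/-- A level 4 teacher controls only the rewards. The reward may depend on the whole history
(most recent experience first), the current state, the agent's action and the next state. -/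
abbrev Teacher (S A : Type) : Type := List (Experience S A) → S → A → S → ℝ

section Protocol

variable {S A : Type} [Fintype A] [Nontrivial A]

/-- The law of the current state: it is drawn from `μ₀` at the start of each episode of `H` steps,
and it is the last sampled state within an episode. -/
def currentState (M : MDP S A) : List (Experience S A) → PMF S
  | [] => M.μ₀
  | e :: h => if (h.length + 1) % M.H = 0 then M.μ₀ else PMF.pure e.next

/-- One step of the protocol: the agent acts by its behavior policy, the next state is sampled from
the MDP, the teacher provides the reward, and the experience is appended to the history. -/
def protocolStep (M : MDP S A) (L : Learner S A) (Q₀ : QTable S A) (τ : Teacher S A)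
    (h : List (Experience S A)) : PMF (List (Experience S A)) :=
  (currentState M h).bind fun s =>
    (L.behavior (L.table Q₀ h) s).bind fun a =>
      (M.P s a).bind fun s' => PMF.pure (⟨s, a, τ h s a s', s'⟩ :: h)

/-- The law of the history after `n` time steps. -/
def historyLaw (M : MDP S A) (L : Learner S A) (Q₀ : QTable S A) (τ : Teacher S A) :
    ℕ → PMF (List (Experience S A))
  | 0 => PMF.pure []
  | n + 1 => (historyLaw M L Q₀ τ n).bind (protocolStep M L Q₀ τ)

/-- The probability that `T > n`, where `T` is the first time at which the target policy is
learned: no initial part of the history up to time `n` has led to the target policy. -/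
def probNotDone (M : MDP S A) (L : Learner S A) (Q₀ : QTable S A) (target : S → A)
    (τ : Teacher S A) (n : ℕ) : ℝ≥0∞ :=
  (historyLaw M L Q₀ τ n).toOuterMeasure
    {h | ∀ h', h' <:+ h → ¬ Taught target (L.table Q₀ h')}

/-- The expected teaching length `E[T] = ∑ₙ P(T > n)` of a teacher (`⊤` if `T` is not integrable,
in particular if the target is missed with positive probability). -/
def expectedLength (M : MDP S A) (L : Learner S A) (Q₀ : QTable S A) (target : S → A)
    (τ : Teacher S A) : ℝ≥0∞ :=
  ∑' n : ℕ, probNotDone M L Q₀ target τ n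

/-- The minimum expected teaching length of a teaching problem instance, for level 4 teachers. -/
def METaL (M : MDP S A) (L : Learner S A) (Q₀ : QTable S A) (target : S → A) : ℝ≥0∞ :=
  ⨅ τ : Teacher S A, expectedLength M L Q₀ target τ

/-- The (level 4) teaching dimension of a learner with respect to a family of MDPs: the worst case
over target policies, initial Q-tables and members of the family. -/
def TDim (L : Learner S A) (F : Set (MDP S A)) : ℝ≥0∞ :=
  ⨆ (target : S → A) (Q₀ : QTable S A) (M : MDP S A) (_ : M ∈ F), METaL M L Q₀ target

end Protocol

/-- The quantity `(S - D) A H (1 / (p (1 - ε))) ^ D`, with `1 / 0 = ∞`. -/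
def rate (S A H D : ℕ) (p : ℝ≥0∞) (ε : ℝ) : ℝ≥0∞ :=
  ((S - D : ℕ) : ℝ≥0∞) * (A : ℝ≥0∞) * (H : ℝ≥0∞) * (1 / (p * ENNReal.ofReal (1 - ε))) ^ D

end RLTeaching

end

/-!
# Lower bounds for the teaching dimension of Q-learners

The argument is a drift bound. Let `X` be a function of the history that has to reach a level `t`
before teaching can end, and let `G` be a function of the state such that `X + G` does not grow in
expectation within an episode, whatever the teacher does. Then an episode contributes at most the
initial expectation of `G` to the expectation of `X` (`IsDrift.expect_le`), so that by Markov's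
inequality teaching goes on with probability at least `1 / 2` for about `t / (2 * G)` episodes
(`le_probNotDone`, `le_expectedLength`).

*Deterministic initial states* (`rate_le_TDim_deterministic`). The MDP consists of a chain of length
`ℓ = D - b`, below which there is a full binary tree of depth `b`. Every failed or wrong action, and
every action in a leaf, leaves the tree for the rest of the episode, so an episode visits at most
one leaf, and acts there once. The remaining states form another binary tree, where episodes that
have failed end up. The largest `b` that fits has `2 ^ b ≥ (S - D) / 4` leaves. The target action
starts out as the worst one in every state. So in every leaf, it or all other actions must be tried,
and `X` counts the progress in this respect: `A - 1` is needed for each leaf, and one visit brings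
at most `2` on average (`expect_score_cons_le`). One chain level is passed with probability at most
`p * (1 - ε)`. On a branching level both children are good, which costs a factor
`1 + ε / ((A - 1) * (1 - ε))` in comparison, but the product of these factors is at most `e` under
the hypothesis on `ε` (`add_div_pow_le`). So `G` is `O((p * (1 - ε)) ^ D)` at the initial state.
If this bound is less than one episode, it is replaced by another one: the first step of the first
episode succeeds with probability at most `1 / 2`, because the action that descends from the initial
state starts out as the worst one there (`expect_visits_treeLeaves_le`).

*Arbitrary initial distributions* (`TDim_eq_top`). The minimum transition probability and the
diameter do not limit how small the positive initial probabilities may be. If a state in need of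
teaching cannot be entered from other states and is initial with probability `δ`, teaching takes
about `1 / δ` steps, and the teaching dimension of the whole family is infinite.
-/

open scoped ENNReal NNReal

noncomputable section

namespace RLTeaching

/-! ### Expectations under a probability mass function -/

/-- The expectation of a nonnegative function under a `PMF`. -/
def expect {α : Type*} (μ : PMF α) (g : α → ℝ≥0∞) : ℝ≥0∞ :=
  ∑' x, μ x * g x

section Expect

variable {α β : Type*}

lemma expect_pure (a : α) (g : α → ℝ≥0∞) : expect (PMF.pure a) g = g a := by
  classical
  unfold expect
  rw [tsum_eq_single a]
  · simp
  · intro b hb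
    simp [PMF.pure_apply, hb]

lemma expect_bind (μ : PMF α) (k : α → PMF β) (g : β → ℝ≥0∞) :
    expect (μ.bind k) g = expect μ fun a => expect (k a) g := by
  unfold expect
  simp_rw [PMF.bind_apply, ← ENNReal.tsum_mul_right, ← ENNReal.tsum_mul_left]
  rw [ENNReal.tsum_comm]
  simp_rw [mul_assoc]

lemma expect_mono_support (μ : PMF α) {f g : α → ℝ≥0∞} (h : ∀ x ∈ μ.support, f x ≤ g x) :
    expect μ f ≤ expect μ g := by
  refine ENNReal.tsum_le_tsum fun x => ?_
  by_cases hx : μ x = 0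
  · simp [hx]
  · gcongr
    exact h x hx

lemma expect_mono (μ : PMF α) {f g : α → ℝ≥0∞} (h : ∀ x, f x ≤ g x) :
    expect μ f ≤ expect μ g :=
  expect_mono_support μ fun x _ => h x

lemma expect_const (μ : PMF α) (c : ℝ≥0∞) : expect μ (fun _ => c) = c := by
  unfold expect
  rw [ENNReal.tsum_mul_right, μ.tsum_coe, one_mul]

lemma expect_add (μ : PMF α) (f g : α → ℝ≥0∞) :
    expect μ (fun x => f x + g x) = expect μ f + expect μ g := by
  unfold expect
  simp_rw [mul_add]
  exact ENNReal.tsum_add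

lemma expect_eq_sum [Fintype α] (μ : PMF α) (g : α → ℝ≥0∞) :
    expect μ g = ∑ x, μ x * g x := tsum_fintype _

/-- Markov's inequality, in a form without subtraction or division. -/
lemma mul_toOuterMeasure_le_expect (μ : PMF α) (g : α → ℝ≥0∞) (t : ℝ≥0∞) (s : Set α)
    (h : ∀ x ∈ s, t ≤ g x) : t * μ.toOuterMeasure s ≤ expect μ g := by
  rw [PMF.toOuterMeasure_apply, ← ENNReal.tsum_mul_left]
  refine ENNReal.tsum_le_tsum fun x => ?_
  by_cases hx : x ∈ s
  · rw [Set.indicator_of_mem hx, mul_comm]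
    gcongr
    exact h x hx
  · simp [hx]

lemma one_le_toOuterMeasure_add_compl (μ : PMF α) (s : Set α) :
    1 ≤ μ.toOuterMeasure s + μ.toOuterMeasure sᶜ := by
  rw [PMF.toOuterMeasure_apply, PMF.toOuterMeasure_apply, ← ENNReal.tsum_add, ← μ.tsum_coe]
  refine ENNReal.tsum_le_tsum fun x => ?_
  by_cases hx : x ∈ s <;> simp [hx]

end Expect

/-! ### Two-point transition kernels -/

section TwoPoint

variable {S A : Type} [Fintype S]

open Classical in
/-- The distribution with mass `p` at `y` and mass `1 - p` at `d` (a point mass if `y = d`). -/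
def twoPoint (p : ℝ≥0∞) (hp : p ≤ 1) (y d : S) : PMF S :=
  PMF.ofFintype (fun x => (if x = y then p else 0) + (if x = d then 1 - p else 0)) (by
    rw [Finset.sum_add_distrib]
    simp [add_tsub_cancel_of_le hp])

open Classical in
lemma twoPoint_apply (p : ℝ≥0∞) (hp : p ≤ 1) (y d x : S) :
    twoPoint p hp y d x = (if x = y then p else 0) + (if x = d then 1 - p else 0) := rfl

lemma expect_twoPoint (p : ℝ≥0∞) (hp : p ≤ 1) (y d : S) (g : S → ℝ≥0∞) :
    expect (twoPoint p hp y d) g = p * g y + (1 - p) * g d := by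
  classical
  rw [expect_eq_sum]
  simp_rw [twoPoint_apply, add_mul]
  rw [Finset.sum_add_distrib]
  simp [ite_mul]

lemma expect_twoPoint_le {p : ℝ≥0∞} (hp : p ≤ 1) {y d : S} {g : S → ℝ≥0∞} {c : ℝ≥0∞}
    (hy : g y ≤ c) (hd : g d ≤ c) : expect (twoPoint p hp y d) g ≤ c := by
  rw [expect_twoPoint]
  calc p * g y + (1 - p) * g d ≤ p * c + (1 - p) * c := by gcongr
    _ = c := by rw [← add_mul, add_tsub_cancel_of_le hp, one_mul]

lemma twoPoint_pos_left {p : ℝ≥0∞} (hp : p ≤ 1) (h0 : 0 < p) (y d : S) :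
    0 < twoPoint p hp y d y := by
  rw [twoPoint_apply, if_pos rfl]
  exact lt_of_lt_of_le h0 le_self_add

lemma eq_or_eq_of_twoPoint_pos {p : ℝ≥0∞} {hp : p ≤ 1} {y d x : S}
    (h : 0 < twoPoint p hp y d x) : x = y ∨ x = d := by
  by_contra! hx
  simp [twoPoint_apply, hx.1, hx.2] at h

/-- The MDP in which action `a` in state `s` leads to `next s a` with probability `p`, and
otherwise to the fallback state `fb s`. The rewards are irrelevant for teaching, since the teacher
replaces them. -/
def twoPointMDP (μ₀ : PMF S) (H : ℕ) (p : ℝ≥0∞) (hp : p ≤ 1) (next : S → A → S) (fb : S → S) :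
    MDP S A where
  R _ _ := 0
  P s a := twoPoint p hp (next s a) (fb s)
  μ₀ := μ₀
  H := H

lemma pMin_twoPointMDP (μ₀ : PMF S) (H : ℕ) {p : ℝ≥0∞} (hp : p ≤ 1) (h0 : 0 < p)
    (h2 : p = 1 ∨ p ≤ 1 / 2) (next : S → A → S) (fb : S → S) (s : S) (a : A)
    (hne : next s a ≠ fb s) : (twoPointMDP μ₀ H p hp next fb).pMin = p := by
  apply le_antisymm
  · refine (iInf_le_of_le s <| iInf_le_of_le a <| iInf_le_of_le (next s a) <|
      iInf_le_of_le (twoPoint_pos_left hp h0 _ _) ?_)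
    simp [twoPointMDP, twoPoint_apply, hne]
  · refine le_iInf fun s => le_iInf fun a => le_iInf fun s' => le_iInf fun hpos => ?_
    simp only [twoPointMDP, twoPoint_apply] at hpos ⊢
    by_cases h : s' = next s a
    · simp [h]
    · by_cases h' : s' = fb s
      · rw [if_neg h, if_pos h', zero_add] at hpos ⊢
        rcases h2 with rfl | h2
        · simp at hpos
        · refine ENNReal.le_sub_of_add_le_left (ne_top_of_le_ne_top ENNReal.one_ne_top hp) ?_
          calc p + p ≤ 1 / 2 + 1 / 2 := add_le_add h2 h2
            _ = 1 := ENNReal.add_halves 1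
      · simp [h, h'] at hpos

/-- The minimum transition probability of a finite MDP is positive, and it is `1` (if all
transitions are deterministic) or at most `1 / 2`. -/
lemma MDP.pMin_pos_and [Nonempty S] [Fintype A] [Nonempty A] (M : MDP S A) :
    0 < M.pMin ∧ (M.pMin = 1 ∨ M.pMin ≤ 1 / 2) := by
  classical
  set T : Finset (S × A × S) := Finset.univ.filter fun x => 0 < M.P x.1 x.2.1 x.2.2 with hT
  obtain ⟨s₁⟩ := ‹Nonempty S›
  obtain ⟨a₁⟩ := ‹Nonempty A›
  obtain ⟨s₂, hs₂⟩ := (M.P s₁ a₁).support_nonempty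
  have hne : T.Nonempty := ⟨(s₁, a₁, s₂), by simpa [hT, pos_iff_ne_zero] using hs₂⟩
  obtain ⟨⟨s, a, s'⟩, hmem, hmin⟩ := T.exists_min_image (fun x => M.P x.1 x.2.1 x.2.2) hne
  have hpos : 0 < M.P s a s' := by simpa [hT] using hmem
  have hle : ∀ s a s', 0 < M.P s a s' → M.pMin ≤ M.P s a s' := fun s a s' h =>
    iInf_le_of_le s <| iInf_le_of_le a <| iInf_le_of_le s' <| iInf_le_of_le h le_rfl
  have heq : M.pMin = M.P s a s' := by
    refine le_antisymm (hle s a s' hpos) ?_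
    refine le_iInf fun t => le_iInf fun b => le_iInf fun t' => le_iInf fun h => ?_
    exact hmin (t, b, t') (by simpa [hT] using h)
  refine ⟨heq ▸ hpos, ?_⟩
  by_cases hx : ∃ s'' ≠ s', 0 < M.P s a s''
  · right
    obtain ⟨s'', hne', hpos'⟩ := hx
    have h1 : M.P s a s' + M.P s a s'' ≤ 1 := by
      rw [← (M.P s a).tsum_coe, tsum_fintype, ← Finset.sum_pair hne'.symm]
      exact Finset.sum_le_sum_of_subset (Finset.subset_univ _)
    have h2 : M.pMin + M.pMin ≤ 1 := (add_le_add heq.le (hle _ _ _ hpos')).trans h1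
    rw [ENNReal.le_div_iff_mul_le (by simp) (by simp), mul_two]
    exact h2
  · left
    push Not at hx
    rw [heq, ← (M.P s a).tsum_coe, tsum_eq_single s']
    intro s'' h
    exact le_antisymm (hx s'' h) zero_le

end TwoPoint

/-- If `depth` vanishes on the possible initial states and grows by at most one along every
transition, it bounds the distances from below; if paths of these lengths exist as well, it is the
distance function, and its maximum is the diameter. -/
lemma diam_eq_of_depth {S A : Type} (M : MDP S A) (D : ℕ) (depth : S → ℕ)
    (h0 : ∀ s, 0 < M.μ₀ s → depth s = 0)
    (hstep : ∀ s a s', 0 < M.P s a s' → depth s' ≤ depth s + 1)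
    (hreach : ∀ s, M.ReachIn (depth s) s) (hle : ∀ s, depth s ≤ D) (heq : ∃ s, depth s = D) :
    M.diam = (D : ℕ∞) := by
  have hlow : ∀ T s, M.ReachIn T s → depth s ≤ T := by
    intro T
    induction T with
    | zero => intro s hs; exact (h0 s hs).le
    | succ T ih =>
      rintro s ⟨s', a, hs', hP⟩
      exact (hstep _ _ _ hP).trans (Nat.succ_le_succ (ih _ hs'))
  apply le_antisymm
  · refine iSup_le fun s => iInf_le_of_le (depth s) <| iInf_le_of_le (hreach s) ?_
    exact_mod_cast hle s
  · obtain ⟨s, rfl⟩ := heq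
    refine le_iSup_of_le s <| le_iInf fun T => le_iInf fun h => ?_
    exact_mod_cast hlow T s h

/-! ### The drift bound -/

section Drift

variable {S A : Type} [Fintype A] [Nontrivial A]

lemma length_of_mem_support_historyLaw (M : MDP S A) (L : Learner S A) (Q₀ : QTable S A)
    (τ : Teacher S A) (n : ℕ) :
    ∀ h ∈ (historyLaw M L Q₀ τ n).support, h.length = n := by
  induction n with
  | zero => simp [historyLaw]
  | succ n ih =>
    intro h hh
    rw [historyLaw, PMF.mem_support_bind_iff] at hh
    obtain ⟨h₁, hh₁, hh⟩ := hh
    simp only [protocolStep, PMF.mem_support_bind_iff, PMF.mem_support_pure_iff] at hh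
    obtain ⟨s, -, a, -, s', -, rfl⟩ := hh
    simp [ih h₁ hh₁]

/-- `X` is a nonnegative function of the history and `G` one of the state such that `X + G` does
not grow in expectation within an episode. So `G s` bounds the expected growth of `X` until the end
of an episode that has arrived at `s`. -/
def IsDrift (M : MDP S A) (L : Learner S A) (Q₀ : QTable S A) (τ : Teacher S A)
    (X : List (Experience S A) → ℝ≥0∞) (G : S → ℝ≥0∞) : Prop :=
  ∀ h s, (expect (L.behavior (L.table Q₀ h) s) fun a =>
    expect (M.P s a) fun s' => X (⟨s, a, τ h s a s', s'⟩ :: h) + G s') ≤ X h + G s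

lemma expect_historyLaw_succ (M : MDP S A) (L : Learner S A) (Q₀ : QTable S A) (τ : Teacher S A)
    (n : ℕ) (g : List (Experience S A) → ℝ≥0∞) :
    expect (historyLaw M L Q₀ τ (n + 1)) g = expect (historyLaw M L Q₀ τ n) fun h =>
      expect (currentState M h) fun s => expect (L.behavior (L.table Q₀ h) s) fun a =>
        expect (M.P s a) fun s' => g (⟨s, a, τ h s a s', s'⟩ :: h) := by
  simp only [historyLaw, protocolStep, expect_bind, expect_pure]

/-- Within an episode the potential `X + G` is a supermartingale, and the start of a new episode
adds at most the expectation of `G` under the initial distribution. -/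
lemma IsDrift.expect_succ_le {M : MDP S A} {L : Learner S A} {Q₀ : QTable S A} {τ : Teacher S A}
    {X : List (Experience S A) → ℝ≥0∞} {G : S → ℝ≥0∞} (hd : IsDrift M L Q₀ τ X G) (n : ℕ) :
    (expect (historyLaw M L Q₀ τ (n + 1)) fun h => X h + expect (currentState M h) G) ≤
      (expect (historyLaw M L Q₀ τ n) fun h => X h + expect (currentState M h) G) +
        if M.H ∣ n + 1 then expect M.μ₀ G else 0 := by
  rw [expect_historyLaw_succ, ← expect_const (historyLaw M L Q₀ τ n)
    (if M.H ∣ n + 1 then expect M.μ₀ G else 0), ← expect_add]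
  refine expect_mono_support _ fun h hh => ?_
  have hlen := length_of_mem_support_historyLaw M L Q₀ τ n h hh
  set c : ℝ≥0∞ := if M.H ∣ n + 1 then expect M.μ₀ G else 0 with hc
  have hcur : ∀ s a s', expect (currentState M (⟨s, a, τ h s a s', s'⟩ :: h)) G ≤ G s' + c := by
    intro s a s'
    by_cases hdvd : M.H ∣ n + 1
    · have : (n + 1) % M.H = 0 := Nat.mod_eq_zero_of_dvd hdvd
      simp [currentState, hlen, this, hc, hdvd]
    · have : (n + 1) % M.H ≠ 0 := fun h0 => hdvd (Nat.dvd_of_mod_eq_zero h0)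
      simp [currentState, hlen, this, hc, hdvd, expect_pure]
  calc _ ≤ expect (currentState M h) fun s => expect (L.behavior (L.table Q₀ h) s) fun a =>
        expect (M.P s a) fun s' => (X (⟨s, a, τ h s a s', s'⟩ :: h) + G s') + c := by
        refine expect_mono _ fun s => expect_mono _ fun a => expect_mono _ fun s' => ?_
        rw [add_assoc]
        gcongr
        exact hcur s a s'
    _ = (expect (currentState M h) fun s => expect (L.behavior (L.table Q₀ h) s) fun a =>
        expect (M.P s a) fun s' => (X (⟨s, a, τ h s a s', s'⟩ :: h) + G s')) + c := by
        simp only [expect_add, expect_const]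
    _ ≤ (expect (currentState M h) fun s => X h + G s) + c := by
        gcongr
        exact expect_mono _ fun s => hd h s
    _ = _ := by rw [expect_add, expect_const]

/-- After `n` steps, `n / H` episodes are over and one is under way, and each of them contributes
at most the expectation of `G` under the initial distribution to the growth of `X`. -/
lemma IsDrift.expect_le {M : MDP S A} {L : Learner S A} {Q₀ : QTable S A} {τ : Teacher S A}
    {X : List (Experience S A) → ℝ≥0∞} {G : S → ℝ≥0∞} (hd : IsDrift M L Q₀ τ X G)
    (hX : X [] = 0) (n : ℕ) :
    expect (historyLaw M L Q₀ τ n) X ≤ expect M.μ₀ G * ((1 + n / M.H : ℕ) : ℝ≥0∞) := by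
  have key : (expect (historyLaw M L Q₀ τ n) fun h => X h + expect (currentState M h) G) ≤
      expect M.μ₀ G * ((1 + n / M.H : ℕ) : ℝ≥0∞) := by
    induction n with
    | zero => simp [historyLaw, expect_pure, hX, currentState]
    | succ n ih =>
      refine (hd.expect_succ_le n).trans ?_
      rw [Nat.succ_div]
      split_ifs
      · rw [← add_assoc, Nat.cast_add, mul_add]
        gcongr
        simp
      · simpa using ih
  exact (expect_mono _ fun h => le_self_add).trans key

/-- If teaching cannot end before the history function `X` has reached the level `t`, the
expectation of `X` bounds the probability that teaching is over. -/
lemma le_probNotDone (M : MDP S A) (L : Learner S A) (Q₀ : QTable S A) (target : S → A)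
    (τ : Teacher S A) (X : List (Experience S A) → ℝ≥0∞) (t : ℝ≥0∞)
    (hX : ∀ h h', h' <:+ h → Taught target (L.table Q₀ h') → t ≤ X h) (n : ℕ)
    (ht : 2 * expect (historyLaw M L Q₀ τ n) X ≤ t) (ht0 : t ≠ 0) (htop : t ≠ ⊤) :
    1 / 2 ≤ probNotDone M L Q₀ target τ n := by
  set μ := historyLaw M L Q₀ τ n
  set s : Set (List (Experience S A)) := {h | ∀ h', h' <:+ h → ¬ Taught target (L.table Q₀ h')}
  have h1 := one_le_toOuterMeasure_add_compl μ s
  have h2 : t * μ.toOuterMeasure sᶜ ≤ expect μ X := by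
    refine mul_toOuterMeasure_le_expect μ X t _ fun h hh => ?_
    simp only [s, Set.mem_compl_iff, Set.mem_ofPred_eq, not_forall, not_not] at hh
    obtain ⟨h', hs, ht⟩ := hh
    exact hX h h' hs ht
  have h3 : μ.toOuterMeasure sᶜ ≤ 1 / 2 := by
    have : t * (μ.toOuterMeasure sᶜ * 2) ≤ t * 1 := by
      rw [mul_one]
      refine le_trans (le_of_eq (by ring)) ((mul_le_mul_right h2 2).trans ht)
    rw [ENNReal.mul_le_mul_iff_right ht0 htop] at this
    rwa [ENNReal.le_div_iff_mul_le (by simp) (by simp)]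
  have h4 : (1 : ℝ≥0∞) / 2 + 1 / 2 ≤ μ.toOuterMeasure s + 1 / 2 := by
    rw [ENNReal.add_halves]
    exact h1.trans (by gcongr)
  exact (ENNReal.add_le_add_iff_right (by simp)).1 h4

/-- If teaching goes on at each of the first `N` times with probability at least `1 / 2`, it takes
at least `N / 2` steps on average. -/
lemma le_expectedLength (M : MDP S A) (L : Learner S A) (Q₀ : QTable S A) (target : S → A)
    (τ : Teacher S A) (N : ℕ) (h : ∀ n < N, 1 / 2 ≤ probNotDone M L Q₀ target τ n) :
    (N : ℝ≥0∞) / 2 ≤ expectedLength M L Q₀ target τ := by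
  refine le_trans ?_ (ENNReal.sum_le_tsum (Finset.range N))
  calc (N : ℝ≥0∞) / 2 = ∑ n ∈ Finset.range N, 1 / 2 := by
        simp [div_eq_mul_inv]
    _ ≤ _ := Finset.sum_le_sum fun n hn => h n (Finset.mem_range.1 hn)

end Drift

/-- The Q-table keeps its initial values at the pairs that have not been visited. -/
lemma table_eq_of_not_visited {S A : Type} (L : Learner S A) (Q₀ : QTable S A) (s : S) (a : A) :
    ∀ h : List (Experience S A), (∀ e ∈ h, ¬ (e.state = s ∧ e.action = a)) →
      L.table Q₀ h s a = Q₀ s a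
  | [], _ => rfl
  | e :: h, hv => by
    rw [Learner.table, L.f_local _ _ _ _ fun hc =>
      hv e (List.mem_cons_self ..) ⟨hc.1.symm, hc.2.symm⟩]
    exact table_eq_of_not_visited L Q₀ s a h fun e' he' => hv e' (List.mem_cons_of_mem _ he')

/-! ### Numbering the states -/

section Numbering

variable {S : Type} [Fintype S]

/-- The number of a state in a fixed enumeration `0, 1, …, |S| - 1` of the state space. -/
def idx (s : S) : ℕ := Fintype.equivFin S s

open Classical in
/-- The state with a given number; numbers from `|S|` on get an arbitrary state. -/
def nth (S : Type) [Fintype S] [Nonempty S] (i : ℕ) : S :=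
  if h : i < Fintype.card S then (Fintype.equivFin S).symm ⟨i, h⟩ else Classical.arbitrary S

lemma idx_lt (s : S) : idx s < Fintype.card S := (Fintype.equivFin S s).2

variable [Nonempty S]

lemma idx_nth {i : ℕ} (h : i < Fintype.card S) : idx (nth S i) = i := by
  simp [idx, nth, h]

lemma nth_idx (s : S) : nth S (idx s) = s := by
  have h := idx_lt s
  simp only [idx] at h ⊢
  simp [nth]

end Numbering

/-! ### Visits to a set of states -/

/-- The history contains an action taken in one of the states of `B`. -/
def Visits {S A : Type} (B : Set S) (h : List (Experience S A)) : Prop :=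
  ∃ e ∈ h, e.state ∈ B

lemma Visits.mono {S A : Type} {B : Set S} {h h' : List (Experience S A)} (hs : h' <:+ h)
    (hv : Visits B h') : Visits B h :=
  let ⟨e, he, hB⟩ := hv
  ⟨e, hs.subset he, hB⟩

lemma visits_cons {S A : Type} {B : Set S} {e : Experience S A} {h : List (Experience S A)} :
    Visits B (e :: h) ↔ e.state ∈ B ∨ Visits B h := by
  simp [Visits]

/-- A state whose initial row of the Q-table does not induce the target has to be visited. -/
lemma visits_of_taught {S A : Type} {L : Learner S A} {Q₀ : QTable S A} {target : S → A} {s : S}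
    {b : A} (hb : b ≠ target s) (hQ : Q₀ s (target s) ≤ Q₀ s b) {h : List (Experience S A)}
    (ht : Taught target (L.table Q₀ h)) : Visits {s} h := by
  by_contra hv
  have hrow : ∀ a, L.table Q₀ h s a = Q₀ s a := fun a =>
    table_eq_of_not_visited L Q₀ s a h fun e he hc => hv ⟨e, he, hc.1⟩
  have := ht s b hb
  rw [hrow, hrow] at this
  exact absurd hQ (not_le.2 this)

/-! ### Rare initial states -/

section RareStart

variable {S A : Type} [Fintype S] [Nonempty S]

/-- Successful transitions of the chain `1 → 2 → ⋯ → D + 1`; elsewhere they lead to `0`. -/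
def chainNext (S A : Type) [Fintype S] [Nonempty S] (D : ℕ) (s : S) (_ : A) : S :=
  if 1 ≤ idx s ∧ idx s ≤ D then nth S (idx s + 1) else nth S 0

/-- Failing transitions of the chain: they lead to `0`, except that the end of the chain is
kept. -/
def chainFallback (S : Type) [Fintype S] [Nonempty S] (D : ℕ) (s : S) : S :=
  if idx s = D + 1 then s else nth S 0

open Classical in
/-- All states outside of the chain `1 → 2 → ⋯ → D + 1`. -/
def commonStates (S : Type) [Fintype S] (D : ℕ) : Finset S :=
  Finset.univ.filter fun s => idx s = 0 ∨ D + 2 ≤ idx s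

lemma commonStates_nonempty (D : ℕ) : (commonStates S D).Nonempty :=
  ⟨nth S 0, by simp [commonStates, idx_nth (S := S) Fintype.card_pos]⟩

/-- The initial distribution that starts the chain with probability `δ`, and is uniform outside
of it otherwise. -/
def rareStart (S : Type) [Fintype S] [Nonempty S] (D : ℕ) (δ : ℝ≥0∞) (hδ : δ ≤ 1) : PMF S :=
  (PMF.uniformOfFinset (commonStates S D) (commonStates_nonempty D)).bind fun s =>
    twoPoint δ hδ (nth S 1) s

/-- The MDP whose hardest state can only be reached through a chain with a rare start. -/
def rareStartMDP (S A : Type) [Fintype S] [Nonempty S] (H D : ℕ) (p : ℝ≥0∞) (hp : p ≤ 1)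
    (δ : ℝ≥0∞) (hδ : δ ≤ 1) : MDP S A :=
  twoPointMDP (rareStart S D δ hδ) H p hp (chainNext S A D) (chainFallback S D)

lemma rareStart_pos_iff {D : ℕ} {δ : ℝ≥0∞} {hδ : δ ≤ 1} (hpos : 0 < δ) (hlt : δ < 1) (s : S) :
    0 < rareStart S D δ hδ s ↔ s = nth S 1 ∨ s ∈ commonStates S D := by
  rw [pos_iff_ne_zero, rareStart, ← PMF.mem_support_iff, PMF.mem_support_bind_iff]
  constructor
  · rintro ⟨t, ht, hs⟩
    rw [PMF.mem_support_iff, ← pos_iff_ne_zero] at hs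
    rcases eq_or_eq_of_twoPoint_pos hs with h | rfl
    · exact Or.inl h
    · exact Or.inr (by simpa using ht)
  · rintro (rfl | h)
    · obtain ⟨t, ht⟩ := commonStates_nonempty (S := S) D
      exact ⟨t, (PMF.mem_support_uniformOfFinset_iff _ _).2 ht, (twoPoint_pos_left hδ hpos _ _).ne'⟩
    · refine ⟨s, (PMF.mem_support_uniformOfFinset_iff _ _).2 h, ?_⟩
      rw [PMF.mem_support_iff, twoPoint_apply, ← pos_iff_ne_zero]
      exact lt_of_lt_of_le (by simpa using hlt) le_add_self

lemma rareStartMDP_mem [Nonempty A] {H D : ℕ} {p : ℝ≥0∞} (hp : p ≤ 1) (h0 : 0 < p)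
    (h2 : p = 1 ∨ p ≤ 1 / 2) (hS : D + 2 ≤ Fintype.card S) {δ : ℝ≥0∞} (hδ : δ ≤ 1)
    (hpos : 0 < δ) (hlt : δ < 1) :
    rareStartMDP S A H D p hp δ hδ ∈ mdpFamily S A H D p := by
  obtain ⟨a⟩ := ‹Nonempty A›
  have i0 : idx (nth S 0) = 0 := idx_nth (by omega)
  have i1 : idx (nth S 1) = 1 := idx_nth (by omega)
  have iD : idx (nth S (D + 1)) = D + 1 := idx_nth (by omega)
  refine ⟨rfl, ?_, ?_⟩
  · refine diam_eq_of_depth _ D (fun s => if idx s ≤ D + 1 then idx s - 1 else 0) ?_ ?_ ?_ ?_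
      ⟨nth S (D + 1), by simp [iD]⟩
    · intro s hs
      rcases (rareStart_pos_iff hpos hlt s).1 hs with rfl | h
      · simp [i1]
      · simp only [commonStates, Finset.mem_filter, Finset.mem_univ, true_and] at h
        split_ifs <;> omega
    · intro s a s' hs
      rcases eq_or_eq_of_twoPoint_pos (hp := hp) hs with rfl | rfl
      · unfold chainNext
        split_ifs with h1 <;> simp only [i0] at * <;> try omega
        rw [idx_nth (by omega)]
        omega
      · unfold chainFallback
        split_ifs <;> simp only [i0] at * <;> omega
    · have hchain : ∀ k ≤ D, (rareStartMDP S A H D p hp δ hδ).ReachIn k (nth S (k + 1)) := by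
        intro k
        induction k with
        | zero => intro _; exact (rareStart_pos_iff hpos hlt _).2 (Or.inl rfl)
        | succ k ih =>
          intro hk
          refine ⟨nth S (k + 1), a, ih (by omega), ?_⟩
          have : chainNext S A D (nth S (k + 1)) a = nth S (k + 1 + 1) := by
            rw [chainNext, idx_nth (by omega), if_pos (by omega)]
          rw [← this]
          exact twoPoint_pos_left hp h0 _ _
      intro s
      by_cases h : 1 ≤ idx s ∧ idx s ≤ D + 1
      · have := hchain (idx s - 1) (by omega)
        rw [Nat.sub_add_cancel h.1, nth_idx] at this
        simpa [h.2] using this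
      · have hd : (if idx s ≤ D + 1 then idx s - 1 else 0) = 0 := by split_ifs <;> omega
        rw [hd]
        refine (rareStart_pos_iff hpos hlt s).2 (Or.inr ?_)
        simp only [commonStates, Finset.mem_filter, Finset.mem_univ, true_and]
        omega
    · intro s
      split_ifs <;> omega
  · refine pMin_twoPointMDP _ H hp h0 h2 _ _ (nth S (D + 1)) a fun h => ?_
    have := congrArg idx h
    simp [chainNext, chainFallback, iD, i0] at this

variable [Fintype A] [Nontrivial A]

open Classical in
/-- The probability that the rare state is visited is at most `δ / p` per episode. -/
lemma rareStart_isDrift {H D : ℕ} {p : ℝ≥0∞} (hp : p ≤ 1) (h0 : 0 < p)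
    (hS : D + 2 ≤ Fintype.card S) {δ : ℝ≥0∞} (hδ : δ ≤ 1) (L : Learner S A) (Q₀ : QTable S A)
    (τ : Teacher S A) :
    IsDrift (rareStartMDP S A H D p hp δ hδ) L Q₀ τ
      (fun h => if Visits {nth S 1} h then 1 else 0)
      (fun s => if s = nth S 1 then p⁻¹ else 0) := by
  have h01 : nth S 0 ≠ nth S 1 := fun h => by
    have := congrArg idx h
    rw [idx_nth (by omega), idx_nth (by omega)] at this
    omega
  have hptop : p ≠ ⊤ := ne_top_of_le_ne_top ENNReal.one_ne_top hp
  intro h s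
  refine (expect_mono _ fun a => ?_).trans (expect_const _ _).le
  have hnext : chainNext S A D s a ≠ nth S 1 := fun h => by
    unfold chainNext at h
    split_ifs at h with h1
    · have := congrArg idx h
      rw [idx_nth (by omega), idx_nth (by omega)] at this
      omega
    · exact h01 h
  simp only [rareStartMDP, twoPointMDP]
  rw [expect_twoPoint, if_neg hnext]
  by_cases hs : s = nth S 1
  · have hv : ∀ s', Visits {nth S 1} (⟨s, a, τ h s a s', s'⟩ :: h) := fun s' =>
      visits_cons.2 (Or.inl hs)
    rw [if_pos (hv _), if_pos (hv _), if_pos hs]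
    -- `1 + (1 - p) / p = 1 / p`: the state is kept with probability `1 - p` if `D = 0`
    calc p * (1 + 0) + (1 - p) * (1 + if chainFallback S D s = nth S 1 then p⁻¹ else 0)
        ≤ p * (1 + 0) + (1 - p) * (1 + p⁻¹) := by
          gcongr
          split_ifs
          · exact le_rfl
          · exact zero_le
      _ = (p + (1 - p)) + (1 - p) * p⁻¹ := by ring
      _ = p * p⁻¹ + (1 - p) * p⁻¹ := by
          rw [add_tsub_cancel_of_le hp, ENNReal.mul_inv_cancel h0.ne' hptop]
      _ = p⁻¹ := by rw [← add_mul, add_tsub_cancel_of_le hp, one_mul]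
      _ ≤ _ := le_add_self
  · have hfb : chainFallback S D s ≠ nth S 1 := by
      unfold chainFallback
      split_ifs
      · exact hs
      · exact h01
    have hv : ∀ s', Visits {nth S 1} (⟨s, a, τ h s a s', s'⟩ :: h) ↔ Visits {nth S 1} h :=
      fun s' => by simp [visits_cons, hs]
    simp only [hv, if_neg hfb, if_neg hs, add_zero]
    rw [← add_mul, add_tsub_cancel_of_le hp, one_mul]

lemma expect_rareStart {D : ℕ} (hS : D + 2 ≤ Fintype.card S) {δ : ℝ≥0∞} (hδ : δ ≤ 1)
    {g : S → ℝ≥0∞} (hg : ∀ s ≠ nth S 1, g s = 0) :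
    expect (rareStart S D δ hδ) g = δ * g (nth S 1) := by
  rw [rareStart, expect_bind]
  refine le_antisymm ((expect_mono_support _ fun s hs => ?_).trans (expect_const _ _).le)
    ((expect_const _ _).symm.le.trans (expect_mono _ fun s => ?_))
  · have hs' : s ≠ nth S 1 := by
      rintro rfl
      simp only [PMF.mem_support_uniformOfFinset_iff, commonStates, Finset.mem_filter,
        Finset.mem_univ, true_and] at hs
      rw [idx_nth (by omega)] at hs
      omega
    rw [expect_twoPoint, hg s hs']
    simp
  · rw [expect_twoPoint]
    exact le_self_add

/-- Since `pMin` does not restrict the initial distribution, a start of probability `δ` that is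
needed for teaching makes teaching take about `1 / δ` steps, which is unbounded. -/
lemma TDim_eq_top (L : Learner S A) {H D : ℕ} {p : ℝ≥0∞} (hp : p ≤ 1) (h0 : 0 < p)
    (h2 : p = 1 ∨ p ≤ 1 / 2) (hS : D + 2 ≤ Fintype.card S) :
    TDim L (mdpFamily S A H D p) = ⊤ := by
  classical
  obtain ⟨a₀, a₁, hne⟩ := exists_pair_ne A
  have hptop : p ≠ ⊤ := ne_top_of_le_ne_top ENNReal.one_ne_top hp
  refine ENNReal.eq_top_of_forall_nnreal_le fun r => ?_
  obtain ⟨N, hN⟩ := exists_nat_ge (2 * r)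
  have hr : (r : ℝ≥0∞) ≤ (N : ℝ≥0∞) / 2 := by
    rw [ENNReal.le_div_iff_mul_le (by simp) (by simp), mul_comm]
    exact_mod_cast hN
  set δ : ℝ≥0∞ := p * (2 * ((1 + N : ℕ) : ℝ≥0∞))⁻¹ with hδdef
  have hinv : (2 * ((1 + N : ℕ) : ℝ≥0∞))⁻¹ < 1 := by
    rw [ENNReal.inv_lt_one]
    exact_mod_cast (by omega : 1 < 2 * (1 + N))
  have hlt : δ < 1 := lt_of_le_of_lt (mul_le_of_le_one_left zero_le hp) hinv
  have hpos : 0 < δ := by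
    rw [hδdef]
    exact ENNReal.mul_pos h0.ne' (ENNReal.inv_ne_zero.2 (by finiteness))
  refine hr.trans (le_iSup_of_le (fun _ => a₀) <| le_iSup_of_le 0 <|
    le_iSup_of_le (rareStartMDP S A H D p hp δ hlt.le) <|
    le_iSup_of_le (rareStartMDP_mem hp h0 h2 hS hlt.le hpos hlt) <| le_iInf fun τ => ?_)
  refine le_expectedLength _ _ _ _ _ _ fun n hn => ?_
  refine le_probNotDone _ _ _ _ _ (fun h => if Visits {nth S 1} h then 1 else 0) 1 ?_ n ?_
    one_ne_zero ENNReal.one_ne_top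
  · intro h h' hs ht
    rw [if_pos (Visits.mono hs (visits_of_taught (target := fun _ => a₀) hne.symm le_rfl ht))]
  · have hb := (rareStart_isDrift (H := H) hp h0 hS hlt.le L 0 τ).expect_le
      (by simp [Visits]) n
    have hG : expect (rareStart S D δ hlt.le) (fun s => if s = nth S 1 then p⁻¹ else 0) =
        (2 * ((1 + N : ℕ) : ℝ≥0∞))⁻¹ := by
      rw [expect_rareStart hS hlt.le fun s hs => if_neg hs, if_pos rfl, hδdef, mul_right_comm,
        ENNReal.mul_inv_cancel h0.ne' hptop, one_mul]
    have hH : (((1 + n / H : ℕ)) : ℝ≥0∞) ≤ ((1 + N : ℕ) : ℝ≥0∞) := by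
      have : n / H ≤ n := Nat.div_le_self n H
      exact_mod_cast (by omega : 1 + n / H ≤ 1 + N)
    calc _ ≤ 2 * ((2 * ((1 + N : ℕ) : ℝ≥0∞))⁻¹ * ((1 + N : ℕ) : ℝ≥0∞)) := by
          refine mul_le_mul_right (hb.trans ?_) 2
          exact mul_le_mul' hG.le hH
      _ = (2 * ((1 + N : ℕ) : ℝ≥0∞)) * (2 * ((1 + N : ℕ) : ℝ≥0∞))⁻¹ := by ring
      _ ≤ 1 := ENNReal.mul_inv_le_one _

end RareStart

/-! ### The behavior policy -/

section Behavior

variable {S A : Type} [Fintype A] [Nontrivial A]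

lemma behavior_of_eq_greedy (L : Learner S A) (Q : QTable S A) (s : S) (a : A)
    (h : a = L.greedy Q s) : L.behavior Q s a = ENNReal.ofReal (1 - L.ε) := by
  simp [Learner.behavior, Learner.behaviorProb, h]

lemma behavior_of_ne_greedy (L : Learner S A) (Q : QTable S A) (s : S) (a : A)
    (h : a ≠ L.greedy Q s) :
    L.behavior Q s a = ENNReal.ofReal (L.ε / ((Fintype.card A : ℝ) - 1)) := by
  simp [Learner.behavior, Learner.behaviorProb, h]

lemma behavior_le (L : Learner S A)
    (hε : ENNReal.ofReal (L.ε / ((Fintype.card A : ℝ) - 1)) ≤ ENNReal.ofReal (1 - L.ε))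
    (Q : QTable S A) (s : S) (a : A) : L.behavior Q s a ≤ ENNReal.ofReal (1 - L.ε) := by
  by_cases h : a = L.greedy Q s
  · exact (behavior_of_eq_greedy L Q s a h).le
  · exact (behavior_of_ne_greedy L Q s a h).le.trans hε

/-- Two different actions are not both greedy. -/
lemma behavior_add_le (L : Learner S A)
    (hε : ENNReal.ofReal (L.ε / ((Fintype.card A : ℝ) - 1)) ≤ ENNReal.ofReal (1 - L.ε))
    (Q : QTable S A) (s : S) {a b : A} (hab : a ≠ b) :
    L.behavior Q s a + L.behavior Q s b ≤
      ENNReal.ofReal (1 - L.ε) + ENNReal.ofReal (L.ε / ((Fintype.card A : ℝ) - 1)) := by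
  by_cases h : a = L.greedy Q s
  · rw [behavior_of_ne_greedy L Q s b (h ▸ hab.symm)]
    exact add_le_add_left (behavior_le L hε Q s a) _
  · rw [behavior_of_ne_greedy L Q s a h, add_comm]
    exact add_le_add_left (behavior_le L hε Q s b) _

end Behavior

/-! ### The teaching progress in a state -/

section Score

variable {S A : Type} [Fintype A]

open Classical in
/-- The actions that have been taken in the state `s`. -/
def triedActions (s : S) (h : List (Experience S A)) : Finset A :=
  Finset.univ.filter fun a => ∃ e ∈ h, e.state = s ∧ e.action = a

open Classical in
/-- The progress in the state `s` on the way to the target action `a₀`, if `a₀` starts out as the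
worst action: the number of other actions that have been tried so far, or all of them if `a₀` itself
has been tried. -/
def score (a₀ : A) (s : S) (h : List (Experience S A)) : ℕ :=
  if a₀ ∈ triedActions s h then Fintype.card A - 1 else (triedActions s h).card

lemma score_nil (a₀ : A) (s : S) : score a₀ s [] = 0 := by
  simp [score, triedActions]

lemma score_le (a₀ : A) (s : S) (h : List (Experience S A)) :
    score a₀ s h ≤ Fintype.card A - 1 := by
  classical
  unfold score
  split_ifs with h0
  · exact le_rfl
  · rw [← Finset.card_univ, ← Finset.card_erase_of_mem (Finset.mem_univ a₀)]
    exact Finset.card_le_card fun a ha =>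
      Finset.mem_erase.2 ⟨fun h => h0 (h ▸ ha), Finset.mem_univ _⟩

lemma triedActions_mono {s : S} {h h' : List (Experience S A)} (hs : h' <:+ h) :
    triedActions s h' ⊆ triedActions s h := by
  intro a ha
  simp only [triedActions, Finset.mem_filter, Finset.mem_univ, true_and] at ha ⊢
  obtain ⟨e, he, hc⟩ := ha
  exact ⟨e, hs.subset he, hc⟩

lemma score_mono {a₀ : A} {s : S} {h h' : List (Experience S A)} (hs : h' <:+ h) :
    score a₀ s h' ≤ score a₀ s h := by
  by_cases h0 : a₀ ∈ triedActions s h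
  · exact (score_le a₀ s h').trans (by rw [score, if_pos h0])
  · have h0' : a₀ ∉ triedActions s h' := fun hc => h0 (triedActions_mono hs hc)
    rw [score, score, if_neg h0, if_neg h0']
    exact Finset.card_le_card (triedActions_mono hs)

lemma score_cons_of_ne {a₀ : A} {s : S} {e : Experience S A} {h : List (Experience S A)}
    (hs : s ≠ e.state) : score a₀ s (e :: h) = score a₀ s h := by
  have : triedActions s (e :: h) = triedActions s h := by
    unfold triedActions
    congr 1
    ext a
    simp [hs.symm]
  rw [score, score, this]

lemma score_cons_le {a₀ : A} {s : S} {e : Experience S A} {h : List (Experience S A)}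
    (ha : e.action ≠ a₀) : score a₀ s (e :: h) ≤ score a₀ s h + 1 := by
  classical
  by_cases h0 : a₀ ∈ triedActions s h
  · refine (score_le _ _ _).trans ?_
    rw [score, if_pos h0]
    omega
  · have hsub : triedActions s (e :: h) ⊆ insert e.action (triedActions s h) := by
      intro a
      simp only [triedActions, Finset.mem_filter, Finset.mem_univ, true_and, Finset.mem_insert,
        List.exists_mem_cons_iff]
      rintro (⟨-, rfl⟩ | h)
      · exact Or.inl rfl
      · exact Or.inr h
    have h0' : a₀ ∉ triedActions s (e :: h) := fun hc => by
      rcases Finset.mem_insert.1 (hsub hc) with h | h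
      · exact ha h.symm
      · exact h0 h
    rw [score, score, if_neg h0, if_neg h0']
    exact (Finset.card_le_card hsub).trans (Finset.card_insert_le _ _)

/-- The target action can only be a maximizer if it has been tried, or all others have been. -/
lemma score_eq_of_isMax {L : Learner S A} {Q₀ : QTable S A} {a₀ : A} {s : S}
    (hQ : ∀ b, b ≠ a₀ → Q₀ s a₀ < Q₀ s b) {h : List (Experience S A)}
    (hmax : ∀ b, L.table Q₀ h s b ≤ L.table Q₀ h s a₀) :
    score a₀ s h = Fintype.card A - 1 := by
  classical
  refine le_antisymm (score_le _ _ _) ?_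
  have hrow : ∀ a, a ∉ triedActions s h → L.table Q₀ h s a = Q₀ s a := fun a ha =>
    table_eq_of_not_visited L Q₀ s a h fun e he hc =>
      ha (by
        simp only [triedActions, Finset.mem_filter, Finset.mem_univ, true_and]
        exact ⟨e, he, hc⟩)
  unfold score
  split_ifs with h0
  · exact le_rfl
  · rw [← Finset.card_univ, ← Finset.card_erase_of_mem (Finset.mem_univ a₀)]
    refine Finset.card_le_card fun b hb => ?_
    by_contra hb'
    have := hmax b
    rw [hrow b hb', hrow a₀ h0] at this
    exact absurd (hQ b (Finset.ne_of_mem_erase hb)) (not_lt.2 this)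

/-- The expected progress of one visit is at most `2`: untargeted actions contribute at most `1`,
and the target action contributes at most `|A| - 1`, but it is taken with probability
`ε / (|A| - 1)` as long as there is any progress left to make. -/
lemma expect_score_cons_le [Nontrivial A] (L : Learner S A) {Q₀ : QTable S A} {a₀ : A} {s : S}
    (hQ : ∀ b, b ≠ a₀ → Q₀ s a₀ < Q₀ s b) (h : List (Experience S A)) (g : A → ℝ≥0∞)
    (hg : ∀ a, ∃ r s', g a = (score a₀ s (⟨s, a, r, s'⟩ :: h) : ℕ)) :
    expect (L.behavior (L.table Q₀ h) s) g ≤ (score a₀ s h : ℝ≥0∞) + 2 := by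
  classical
  by_cases hgr : a₀ = L.greedy (L.table Q₀ h) s
  · refine ((expect_mono _ fun a => ?_).trans (expect_const _ (score a₀ s h : ℝ≥0∞)).le).trans
      le_self_add
    obtain ⟨r, s', hga⟩ := hg a
    have hmax : ∀ b, L.table Q₀ h s b ≤ L.table Q₀ h s a₀ := fun b => hgr ▸ L.greedy_max _ s b
    rw [hga, score_eq_of_isMax hQ hmax]
    exact_mod_cast score_le _ _ _
  · set inc : A → ℝ≥0∞ := fun a => if a = a₀ then ((Fintype.card A - 1 : ℕ) : ℝ≥0∞) else 0
    have hle : ∀ a, g a ≤ ((score a₀ s h : ℝ≥0∞) + 1) + inc a := by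
      intro a
      obtain ⟨r, s', hga⟩ := hg a
      rw [hga]
      by_cases ha : a = a₀
      · simp only [inc, if_pos ha]
        refine le_trans ?_ le_add_self
        exact_mod_cast score_le _ _ _
      · simp only [inc, if_neg ha, add_zero]
        exact_mod_cast score_cons_le (e := ⟨s, a, r, s'⟩) ha
    have hinc : expect (L.behavior (L.table Q₀ h) s) inc ≤ 1 := by
      rw [expect_eq_sum]
      simp only [inc, mul_ite, mul_zero, Finset.sum_ite_eq', Finset.mem_univ, if_true]
      have hc : ((Fintype.card A - 1 : ℕ) : ℝ≥0∞) =
          ENNReal.ofReal ((Fintype.card A : ℝ) - 1) := by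
        rw [← ENNReal.ofReal_natCast, Nat.cast_sub Fintype.card_pos, Nat.cast_one]
      have hpos := Learner.card_sub_one_pos (A := A)
      rw [behavior_of_ne_greedy _ _ _ _ hgr, hc,
        ← ENNReal.ofReal_mul (div_nonneg L.ε_nonneg hpos.le), div_mul_cancel₀ _ hpos.ne']
      exact ENNReal.ofReal_le_one.2 L.ε_le_one
    calc _ ≤ expect (L.behavior (L.table Q₀ h) s) fun a =>
          ((score a₀ s h : ℝ≥0∞) + 1) + inc a := expect_mono _ hle
      _ ≤ ((score a₀ s h : ℝ≥0∞) + 1) + 1 := by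
          rw [expect_add, expect_const]
          gcongr
      _ = _ := by rw [add_assoc, one_add_one_eq_two]

end Score

/-! ### The shape of the tree -/

/-- The first number behind the chain `0, …, ℓ - 1` and the full binary tree of depth `b` that hangs
below it. This number is the root of a third part, in which nothing can be gained. -/
def dumpRoot (ℓ b : ℕ) : ℕ := ℓ + (2 ^ (b + 1) - 1)

/-- The child `c ∈ {0, 1}` of the state with number `x`. A chain state `x` has its successor as
child `0`. The two other parts are binary heaps: their labels start at `1`, at the numbers `ℓ` and
`dumpRoot ℓ b`, and `i` has the children `2 * i` and `2 * i + 1`. Missing children are replaced by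
`dumpRoot ℓ b`. -/
def treeChild (ℓ b n x c : ℕ) : ℕ :=
  if x < ℓ then
    if c = 0 then x + 1 else dumpRoot ℓ b
  else if x < dumpRoot ℓ b then
    if 2 * (x - ℓ + 1) + c < 2 ^ (b + 1) then ℓ - 1 + (2 * (x - ℓ + 1) + c) else dumpRoot ℓ b
  else
    if dumpRoot ℓ b - 1 + (2 * (x - dumpRoot ℓ b + 1) + c) < n then
      dumpRoot ℓ b - 1 + (2 * (x - dumpRoot ℓ b + 1) + c)
    else dumpRoot ℓ b

/-- The distance of the state with number `x` from the state `0`. -/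
def treeDepth (ℓ b x : ℕ) : ℕ :=
  if x < ℓ then x
  else if x < dumpRoot ℓ b then ℓ + Nat.log 2 (x - ℓ + 1)
  else 1 + Nat.log 2 (x - dumpRoot ℓ b + 1)

/-- The numbers of the leaves of the full binary tree. -/
def IsTreeLeaf (ℓ b x : ℕ) : Prop := ℓ + 2 ^ b ≤ x + 1 ∧ x < dumpRoot ℓ b

section Shape

variable {ℓ b n x : ℕ}

lemma log_two_mul_add {i c : ℕ} (hi : 1 ≤ i) (hc : c ≤ 1) :
    Nat.log 2 (2 * i + c) = Nat.log 2 i + 1 := by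
  rw [Nat.log_of_one_lt_of_le (by omega) (by omega)]
  congr 2
  omega

lemma treeDepth_tree (hℓ : 1 ≤ ℓ) {i : ℕ} (hi : 1 ≤ i) (hb : i < 2 ^ (b + 1)) :
    treeDepth ℓ b (ℓ - 1 + i) = ℓ + Nat.log 2 i := by
  rw [treeDepth, if_neg (by omega), if_pos (by unfold dumpRoot; omega)]
  congr 2
  omega

lemma treeDepth_dump (hℓ : 1 ≤ ℓ) {i : ℕ} (hi : 1 ≤ i) :
    treeDepth ℓ b (dumpRoot ℓ b - 1 + i) = 1 + Nat.log 2 i := by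
  have : ℓ ≤ dumpRoot ℓ b := by unfold dumpRoot; omega
  rw [treeDepth, if_neg (by omega), if_neg (by omega)]
  congr 2
  omega

lemma treeDepth_dumpRoot (hℓ : 1 ≤ ℓ) : treeDepth ℓ b (dumpRoot ℓ b) = 1 := by
  have := treeDepth_dump (b := b) hℓ le_rfl
  rw [Nat.sub_add_cancel (by unfold dumpRoot; omega)] at this
  simpa using this

lemma treeChild_lt (hℓ : 1 ≤ ℓ) (hn : dumpRoot ℓ b < n) (c : ℕ) :
    treeChild ℓ b n x c < n := by
  have h2 : 2 ≤ 2 ^ (b + 1) := by rw [pow_succ]; have := Nat.one_le_two_pow (n := b); omega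
  unfold treeChild
  split_ifs <;> unfold dumpRoot at * <;> omega

lemma treeDepth_treeChild_le (hℓ : 1 ≤ ℓ) {c : ℕ} (hc : c ≤ 1) :
    treeDepth ℓ b (treeChild ℓ b n x c) ≤ treeDepth ℓ b x + 1 := by
  have hroot := treeDepth_dumpRoot (b := b) hℓ
  by_cases h1 : x < ℓ
  · have hx : treeDepth ℓ b x = x := if_pos h1
    rw [treeChild, if_pos h1, hx]
    split_ifs
    · by_cases h2 : x + 1 < ℓ
      · rw [treeDepth, if_pos h2]
      · have h2' : x + 1 = ℓ - 1 + 1 := by omega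
        rw [h2', treeDepth_tree hℓ le_rfl (Nat.one_lt_two_pow (by omega))]
        simp; omega
    · omega
  · by_cases h2 : x < dumpRoot ℓ b
    · rw [treeChild, if_neg h1, if_pos h2]
      split_ifs with h3
      · rw [treeDepth_tree hℓ (by omega) h3, log_two_mul_add (by omega) hc, treeDepth, if_neg h1,
          if_pos h2]
        omega
      · omega
    · rw [treeChild, if_neg h1, if_neg h2]
      split_ifs with h3
      · rw [treeDepth_dump hℓ (by omega), log_two_mul_add (by omega) hc, treeDepth, if_neg h1,
          if_neg h2]
        omega
      · omega

/-- Every state but `0` is a child of a state that is closer to `0`. -/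
lemma exists_treeChild_eq (hℓ : 1 ≤ ℓ) (hx : x < n) (h0 : x ≠ 0) :
    ∃ y < n, ∃ c ≤ 1, treeChild ℓ b n y c = x ∧ treeDepth ℓ b x = treeDepth ℓ b y + 1 := by
  have hℓr : ℓ < dumpRoot ℓ b := by
    have := Nat.one_lt_two_pow (n := b + 1) (by omega)
    unfold dumpRoot; omega
  by_cases h1 : x ≤ ℓ
  · refine ⟨x - 1, by omega, 0, by omega, ?_, ?_⟩
    · rw [treeChild, if_pos (by omega), if_pos rfl]; omega
    · have : treeDepth ℓ b (x - 1) = x - 1 := if_pos (by omega)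
      rw [this]
      by_cases h2 : x < ℓ
      · rw [treeDepth, if_pos h2]; omega
      · have h2' : x = ℓ - 1 + 1 := by omega
        rw [h2', treeDepth_tree hℓ le_rfl (Nat.one_lt_two_pow (by omega))]
        simp
        omega
  · by_cases h2 : x < dumpRoot ℓ b
    · -- the parent of the label `i` is `i / 2`
      obtain ⟨i, rfl⟩ : ∃ i, x = ℓ - 1 + i := ⟨x - (ℓ - 1), by omega⟩
      have hi : i < 2 ^ (b + 1) := by unfold dumpRoot at h2; omega
      have hsub : ℓ - 1 + i / 2 - ℓ + 1 = i / 2 := by omega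
      refine ⟨ℓ - 1 + i / 2, by omega, i % 2, by omega, ?_, ?_⟩
      · rw [treeChild, if_neg (by omega), if_pos (by omega), hsub, if_pos (by omega)]
        omega
      · rw [treeDepth_tree hℓ (by omega) hi, treeDepth_tree hℓ (by omega) (by omega), add_assoc,
          ← log_two_mul_add (i := i / 2) (c := i % 2) (by omega) (by omega), Nat.div_add_mod]
    · obtain ⟨i, rfl⟩ : ∃ i, x = dumpRoot ℓ b - 1 + i := ⟨x - (dumpRoot ℓ b - 1), by omega⟩
      by_cases h3 : i = 1
      · subst h3
        refine ⟨0, by omega, 1, le_rfl, ?_, ?_⟩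
        · rw [treeChild, if_pos (by omega), if_neg (by omega)]; omega
        · rw [treeDepth_dump hℓ le_rfl, treeDepth, if_pos (by omega)]; simp
      · have hsub : dumpRoot ℓ b - 1 + i / 2 - dumpRoot ℓ b + 1 = i / 2 := by omega
        refine ⟨dumpRoot ℓ b - 1 + i / 2, by omega, i % 2, by omega, ?_, ?_⟩
        · rw [treeChild, if_neg (by omega), if_neg (by omega), hsub, if_pos (by omega)]
          omega
        · rw [treeDepth_dump hℓ (by omega), treeDepth_dump hℓ (by omega), add_assoc,
            ← log_two_mul_add (i := i / 2) (c := i % 2) (by omega) (by omega), Nat.div_add_mod]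

lemma treeDepth_le (hx : x < n) (hn : n < dumpRoot ℓ b + 2 ^ (ℓ + b)) :
    treeDepth ℓ b x ≤ ℓ + b := by
  unfold treeDepth
  split_ifs with h1 h2
  · omega
  · have : Nat.log 2 (x - ℓ + 1) < b + 1 :=
      Nat.log_lt_of_lt_pow (by omega) (by unfold dumpRoot at h2; omega)
    omega
  · have : Nat.log 2 (x - dumpRoot ℓ b + 1) < ℓ + b :=
      Nat.log_lt_of_lt_pow (by omega) (by omega)
    omega

lemma log_eq_of_isTreeLeaf (h : IsTreeLeaf ℓ b x) : Nat.log 2 (x - ℓ + 1) = b := by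
  obtain ⟨h1, h2⟩ := h
  have := Nat.one_le_two_pow (n := b)
  unfold dumpRoot at h2
  exact Nat.log_eq_of_pow_le_of_lt_pow (by omega) (by omega)

lemma treeChild_of_isTreeLeaf (h : IsTreeLeaf ℓ b x) (c : ℕ) :
    treeChild ℓ b n x c = dumpRoot ℓ b := by
  obtain ⟨h1, h2⟩ := h
  have := Nat.one_le_two_pow (n := b)
  rw [treeChild, if_neg (by omega), if_pos h2, if_neg (by rw [pow_succ]; omega)]

lemma dumpRoot_le_treeChild (h : dumpRoot ℓ b ≤ x) (c : ℕ) :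
    dumpRoot ℓ b ≤ treeChild ℓ b n x c := by
  have : ℓ ≤ dumpRoot ℓ b := by unfold dumpRoot; omega
  rw [treeChild, if_neg (by omega), if_neg (by omega)]
  split_ifs <;> omega

/-- The bound for the expected progress in the rest of an episode that has arrived at the state with
number `x`: a leaf contributes `2`, each level of the binary tree a factor `r`, and each level of
the chain a factor `q`. -/
def treeGain (q r : ℝ≥0∞) (ℓ b x : ℕ) : ℝ≥0∞ :=
  if x < dumpRoot ℓ b then q ^ (ℓ - x) * (2 * r ^ (b - Nat.log 2 (x - ℓ + 1))) else 0

lemma treeGain_of_le {q r : ℝ≥0∞} (h : dumpRoot ℓ b ≤ x) : treeGain q r ℓ b x = 0 :=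
  if_neg (by omega)

lemma treeGain_leaf {q r : ℝ≥0∞} (h : IsTreeLeaf ℓ b x) : treeGain q r ℓ b x = 2 := by
  have := Nat.one_le_two_pow (n := b)
  rw [treeGain, if_pos h.2, log_eq_of_isTreeLeaf h]
  simp [Nat.sub_eq_zero_of_le (show ℓ ≤ x by have := h.1; omega)]

/-- One step inside the tree: `β₀` and `β₁` are the probabilities of descending to the children. -/
lemma treeGain_step {q r p β₀ β₁ : ℝ≥0∞} (hℓ : 1 ≤ ℓ) (hq : p * β₀ ≤ q)
    (hr : p * (β₀ + β₁) ≤ r) (hx : ¬ IsTreeLeaf ℓ b x) :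
    p * (β₀ * treeGain q r ℓ b (treeChild ℓ b n x 0) +
      β₁ * treeGain q r ℓ b (treeChild ℓ b n x 1)) ≤ treeGain q r ℓ b x := by
  have hℓr : ℓ < dumpRoot ℓ b := by
    have := Nat.one_lt_two_pow (n := b + 1) (by omega)
    unfold dumpRoot; omega
  by_cases h1 : x < ℓ
  · have e1 : treeChild ℓ b n x 1 = dumpRoot ℓ b := by
      rw [treeChild, if_pos h1, if_neg one_ne_zero]
    have e0 : treeChild ℓ b n x 0 = x + 1 := by rw [treeChild, if_pos h1, if_pos rfl]
    rw [e1, e0, treeGain_of_le le_rfl, mul_zero, add_zero, ← mul_assoc, treeGain, treeGain,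
      if_pos (by omega), if_pos (by omega), Nat.sub_eq_zero_of_le (by omega : x + 1 ≤ ℓ),
      Nat.sub_eq_zero_of_le h1.le, show ℓ - x = (ℓ - (x + 1)) + 1 by omega, pow_succ']
    calc p * β₀ * (q ^ (ℓ - (x + 1)) * (2 * r ^ (b - Nat.log 2 (0 + 1))))
        ≤ q * (q ^ (ℓ - (x + 1)) * (2 * r ^ (b - Nat.log 2 (0 + 1)))) := by gcongr
      _ = _ := by ring
  · by_cases h2 : x < dumpRoot ℓ b
    · have hi : x - ℓ + 1 < 2 ^ b := by
        by_contra hc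
        exact hx ⟨by omega, h2⟩
      have hlog : Nat.log 2 (x - ℓ + 1) < b := Nat.log_lt_of_lt_pow (by omega) hi
      have hchild : ∀ c ≤ 1, treeGain q r ℓ b (treeChild ℓ b n x c) =
          2 * r ^ (b - (Nat.log 2 (x - ℓ + 1) + 1)) := by
        intro c hc
        have h3 : 2 * (x - ℓ + 1) + c < 2 ^ (b + 1) := by rw [pow_succ]; omega
        rw [treeChild, if_neg h1, if_pos h2, if_pos h3, treeGain,
          if_pos (by unfold dumpRoot; omega), ← log_two_mul_add (by omega) hc,
          Nat.sub_eq_zero_of_le (by omega), pow_zero, one_mul]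
        congr 4
        omega
      rw [hchild 0 (by omega), hchild 1 le_rfl, treeGain, if_pos h2,
        Nat.sub_eq_zero_of_le (by omega : ℓ ≤ x), pow_zero, one_mul, ← add_mul, ← mul_assoc,
        show b - Nat.log 2 (x - ℓ + 1) = b - (Nat.log 2 (x - ℓ + 1) + 1) + 1 by omega, pow_succ']
      calc p * (β₀ + β₁) * (2 * r ^ (b - (Nat.log 2 (x - ℓ + 1) + 1)))
          ≤ r * (2 * r ^ (b - (Nat.log 2 (x - ℓ + 1) + 1))) := by gcongr
        _ = _ := by ring
    · rw [treeGain_of_le (dumpRoot_le_treeChild (by omega) 0),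
        treeGain_of_le (dumpRoot_le_treeChild (by omega) 1)]
      simp

/-- The largest full binary tree that fits. -/
lemma exists_tree_depth {N D : ℕ} (hD : 1 ≤ D) (h1 : D + 2 ≤ N) (h2 : N ≤ 2 ^ D + 1) :
    ∃ b < D, D + 2 ^ (b + 1) ≤ N + b ∧ N + b + 1 < D + 2 ^ (b + 2) := by
  classical
  have hex : ∃ k, N + k < D + 2 ^ (k + 1) := ⟨D, by
    have := Nat.one_lt_two_pow (n := D) (by omega)
    rw [pow_succ]; omega⟩
  have hD' : Nat.find hex ≤ D := Nat.find_min' hex (by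
    have := Nat.one_lt_two_pow (n := D) (by omega)
    rw [pow_succ]; omega)
  have hspec := Nat.find_spec hex
  obtain ⟨b, hb⟩ : ∃ b, Nat.find hex = b + 1 := by
    refine Nat.exists_eq_succ_of_ne_zero fun h => ?_
    rw [h] at hspec
    norm_num at hspec
    omega
  have hmin := Nat.find_min hex (m := b) (by omega)
  rw [hb] at hspec
  exact ⟨b, by omega, by omega, by rw [show b + 2 = b + 1 + 1 from rfl]; omega⟩

end Shape

/-! ### The leaves of the tree -/

section Leaves

variable {S A : Type} [Fintype S]

open Classical in
/-- The states that are leaves of the full binary tree. -/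
def treeLeaves (S : Type) [Fintype S] (ℓ b : ℕ) : Finset S :=
  Finset.univ.filter fun s => IsTreeLeaf ℓ b (idx s)

lemma mem_treeLeaves {ℓ b : ℕ} {s : S} : s ∈ treeLeaves S ℓ b ↔ IsTreeLeaf ℓ b (idx s) := by
  simp [treeLeaves]

variable [Fintype A]

/-- The teaching progress in all leaves together. -/
def leafScore (a₀ : A) (ℓ b : ℕ) (h : List (Experience S A)) : ℝ≥0∞ :=
  ∑ s ∈ treeLeaves S ℓ b, (score a₀ s h : ℝ≥0∞)

lemma leafScore_cons_of_not_mem {a₀ : A} {ℓ b : ℕ} {e : Experience S A}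
    {h : List (Experience S A)} (he : e.state ∉ treeLeaves S ℓ b) :
    leafScore a₀ ℓ b (e :: h) = leafScore a₀ ℓ b h :=
  Finset.sum_congr rfl fun s hs => by
    rw [score_cons_of_ne]
    rintro rfl
    exact he hs

open Classical in
lemma leafScore_cons_of_mem {a₀ : A} {ℓ b : ℕ} {e : Experience S A} {h : List (Experience S A)}
    (he : e.state ∈ treeLeaves S ℓ b) :
    leafScore a₀ ℓ b (e :: h) = (score a₀ e.state (e :: h) : ℝ≥0∞) +
      ∑ s ∈ (treeLeaves S ℓ b).erase e.state, (score a₀ s h : ℝ≥0∞) := by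
  rw [leafScore, ← Finset.add_sum_erase _ _ he]
  congr 1
  refine Finset.sum_congr rfl fun s hs => ?_
  rw [score_cons_of_ne (Finset.ne_of_mem_erase hs)]

end Leaves

/-! ### The tree MDP -/

section Tree

variable {S A : Type} [Fintype S] [Nonempty S]

open Classical in
/-- Successful transitions of the tree MDP: `a₀` descends to child `0`, `a₁` descends to child `1`,
and all other actions leave the tree. -/
def treeNext (S : Type) [Fintype S] [Nonempty S] (a₀ a₁ : A) (ℓ b : ℕ) (s : S) (a : A) : S :=
  nth S (if a = a₀ then treeChild ℓ b (Fintype.card S) (idx s) 0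
    else if a = a₁ then treeChild ℓ b (Fintype.card S) (idx s) 1 else dumpRoot ℓ b)

/-- The MDP that starts at the top of a chain of length `ℓ`, below which there is a full binary tree
of depth `b`. Descending succeeds with probability `p`, and otherwise leaves the tree for the rest
of the episode. -/
def treeMDP (S : Type) [Fintype S] [Nonempty S] (H : ℕ) (p : ℝ≥0∞) (hp : p ≤ 1) (a₀ a₁ : A)
    (ℓ b : ℕ) : MDP S A :=
  twoPointMDP (PMF.pure (nth S 0)) H p hp (treeNext S a₀ a₁ ℓ b) fun _ => nth S (dumpRoot ℓ b)

lemma le_card_treeLeaves {ℓ b : ℕ} (hn : dumpRoot ℓ b < Fintype.card S) :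
    2 ^ b ≤ (treeLeaves S ℓ b).card := by
  have h1 := Nat.one_le_two_pow (n := b)
  have hc : (Finset.Ico (ℓ + 2 ^ b - 1) (dumpRoot ℓ b)).card = 2 ^ b := by
    rw [Nat.card_Ico, dumpRoot, pow_succ]
    omega
  rw [← hc]
  refine Finset.card_le_card_of_injOn (nth S) ?_ ?_
  · intro x hx
    rw [Finset.mem_coe, Finset.mem_Ico] at hx
    rw [Finset.mem_coe, mem_treeLeaves, idx_nth (by omega)]
    exact ⟨by omega, hx.2⟩
  · intro x hx y hy hxy
    rw [Finset.mem_coe, Finset.mem_Ico] at hx hy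
    rw [← idx_nth (S := S) (show x < Fintype.card S by omega), hxy, idx_nth (by omega)]

lemma treeNext_eq {a₀ a₁ : A} {ℓ b : ℕ} (s : S) (a : A) :
    (∃ c ≤ 1, treeNext S a₀ a₁ ℓ b s a = nth S (treeChild ℓ b (Fintype.card S) (idx s) c)) ∨
      treeNext S a₀ a₁ ℓ b s a = nth S (dumpRoot ℓ b) := by
  unfold treeNext
  split_ifs
  · exact Or.inl ⟨0, by omega, rfl⟩
  · exact Or.inl ⟨1, le_rfl, rfl⟩
  · exact Or.inr rfl

lemma treeMDP_mem {H : ℕ} {p : ℝ≥0∞} (hp : p ≤ 1) (h0 : 0 < p) (h2 : p = 1 ∨ p ≤ 1 / 2)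
    {a₀ a₁ : A} (hne : a₀ ≠ a₁) {ℓ b : ℕ} (hℓ : 1 ≤ ℓ) (hn : dumpRoot ℓ b < Fintype.card S)
    (hn' : Fintype.card S < dumpRoot ℓ b + 2 ^ (ℓ + b)) :
    treeMDP S H p hp a₀ a₁ ℓ b ∈ mdpFamily S A H (ℓ + b) p := by
  have hpow := Nat.one_le_two_pow (n := b)
  have hr : dumpRoot ℓ b = ℓ + 2 * 2 ^ b - 1 := by rw [dumpRoot, pow_succ]; omega
  refine ⟨rfl, ?_, ?_⟩
  · refine diam_eq_of_depth _ _ (fun s => treeDepth ℓ b (idx s)) ?_ ?_ ?_ ?_ ?_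
    · intro s hs
      have : s = nth S 0 := by
        by_contra h
        simp [treeMDP, twoPointMDP, h] at hs
      rw [this, idx_nth (by omega), treeDepth, if_pos (by omega)]
    · intro s a s' hs
      have hroot : treeDepth ℓ b (idx (nth S (dumpRoot ℓ b))) ≤ treeDepth ℓ b (idx s) + 1 := by
        rw [idx_nth hn, treeDepth_dumpRoot hℓ]
        omega
      rcases eq_or_eq_of_twoPoint_pos (hp := hp) hs with rfl | rfl
      · rcases treeNext_eq (a₀ := a₀) (a₁ := a₁) (ℓ := ℓ) (b := b) s a with ⟨c, hc, h⟩ | h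
        · rw [h, idx_nth (treeChild_lt hℓ hn c)]
          exact treeDepth_treeChild_le hℓ hc
        · rw [h]
          exact hroot
      · exact hroot
    · have key : ∀ T x, x < Fintype.card S → treeDepth ℓ b x = T →
          (treeMDP S H p hp a₀ a₁ ℓ b).ReachIn T (nth S x) := by
        intro T
        induction T with
        | zero =>
          intro x hx hT
          have : x = 0 := by
            by_contra h
            obtain ⟨y, -, c, -, -, hy⟩ := exists_treeChild_eq (b := b) hℓ hx h
            omega
          subst this
          simp [MDP.ReachIn, treeMDP, twoPointMDP]
        | succ T ih =>
          intro x hx hT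
          have hx0 : x ≠ 0 := by
            rintro rfl
            rw [treeDepth, if_pos (by omega)] at hT
            omega
          obtain ⟨y, hy, c, hc, hyx, hd⟩ := exists_treeChild_eq (b := b) hℓ hx hx0
          refine ⟨nth S y, if c = 0 then a₀ else a₁, ih y hy (by omega), ?_⟩
          have : treeNext S a₀ a₁ ℓ b (nth S y) (if c = 0 then a₀ else a₁) = nth S x := by
            rw [treeNext, idx_nth hy]
            rcases Nat.le_one_iff_eq_zero_or_eq_one.1 hc with rfl | rfl
            · simp [hyx]
            · simp [hyx, hne.symm]
          rw [← this]
          exact twoPoint_pos_left hp h0 _ _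
      intro s
      have := key _ (idx s) (idx_lt s) rfl
      rwa [nth_idx] at this
    · intro s
      exact treeDepth_le (idx_lt s) hn'
    · have hleaf : IsTreeLeaf ℓ b (ℓ + 2 ^ b - 1) := ⟨by omega, by omega⟩
      refine ⟨nth S (ℓ + 2 ^ b - 1), ?_⟩
      rw [idx_nth (by omega), treeDepth, if_neg (by omega), if_pos hleaf.2,
        log_eq_of_isTreeLeaf hleaf]
  · refine pMin_twoPointMDP _ H hp h0 h2 _ _ (nth S 0) a₀ fun h => ?_
    have := congrArg idx h
    rw [treeNext, if_pos rfl, idx_nth (treeChild_lt hℓ hn 0), idx_nth hn, idx_nth (by omega),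
      treeChild, if_pos (by omega), if_pos rfl] at this
    omega

variable [Fintype A] [Nontrivial A]

/-- The drift of the progress in the leaves: reaching a leaf in a given episode has a probability
that falls off geometrically with the distance, and one visit is worth at most `2`. -/
lemma leafScore_isDrift {H : ℕ} {p : ℝ≥0∞} (hp : p ≤ 1) {a₀ a₁ : A} (hne : a₀ ≠ a₁) {ℓ b : ℕ}
    (hℓ : 1 ≤ ℓ) (hn : dumpRoot ℓ b < Fintype.card S) (L : Learner S A)
    (hε : ENNReal.ofReal (L.ε / ((Fintype.card A : ℝ) - 1)) ≤ ENNReal.ofReal (1 - L.ε))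
    {Q₀ : QTable S A} (hQ : ∀ s b, b ≠ a₀ → Q₀ s a₀ < Q₀ s b) (τ : Teacher S A) {q r : ℝ≥0∞}
    (hq : p * ENNReal.ofReal (1 - L.ε) ≤ q)
    (hr : p * (ENNReal.ofReal (1 - L.ε) +
      ENNReal.ofReal (L.ε / ((Fintype.card A : ℝ) - 1))) ≤ r) :
    IsDrift (treeMDP S H p hp a₀ a₁ ℓ b) L Q₀ τ (leafScore a₀ ℓ b)
      (fun s => treeGain q r ℓ b (idx s)) := by
  classical
  intro h s
  set β := L.behavior (L.table Q₀ h) s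
  have hdump : treeGain q r ℓ b (idx (nth S (dumpRoot ℓ b))) = 0 :=
    treeGain_of_le (by rw [idx_nth hn])
  by_cases hs : IsTreeLeaf ℓ b (idx s)
  · have hmem : s ∈ treeLeaves S ℓ b := mem_treeLeaves.2 hs
    have hnext : ∀ a, treeNext S a₀ a₁ ℓ b s a = nth S (dumpRoot ℓ b) := by
      intro a
      rcases treeNext_eq (a₀ := a₀) (a₁ := a₁) (ℓ := ℓ) (b := b) s a with ⟨c, hc, h⟩ | h
      · rw [h, treeChild_of_isTreeLeaf hs]
      · exact h
    set d := nth S (dumpRoot ℓ b)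
    set rest : ℝ≥0∞ := ∑ t ∈ (treeLeaves S ℓ b).erase s, (score a₀ t h : ℝ≥0∞)
    calc _ ≤ expect β fun a =>
          ((score a₀ s (⟨s, a, τ h s a d, d⟩ :: h) : ℕ) : ℝ≥0∞) + rest := by
          refine expect_mono _ fun a => ?_
          have hb : leafScore a₀ ℓ b (⟨s, a, τ h s a d, d⟩ :: h) +
              treeGain q r ℓ b (idx d) ≤
              ((score a₀ s (⟨s, a, τ h s a d, d⟩ :: h) : ℕ) : ℝ≥0∞) + rest := by
            rw [hdump, add_zero, leafScore_cons_of_mem hmem]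
          refine expect_twoPoint_le hp ?_ hb
          rw [hnext a]
          exact hb
      _ ≤ ((score a₀ s h : ℝ≥0∞) + 2) + rest := by
          rw [expect_add, expect_const]
          gcongr
          exact expect_score_cons_le L (hQ s) h _ fun a => ⟨_, _, rfl⟩
      _ = ((score a₀ s h : ℝ≥0∞) + rest) + 2 := by ring
      _ = leafScore a₀ ℓ b h + treeGain q r ℓ b (idx s) := by
          rw [treeGain_leaf hs, leafScore, ← Finset.add_sum_erase _ _ hmem]
  · have hmem : s ∉ treeLeaves S ℓ b := fun h => hs (mem_treeLeaves.1 h)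
    have hX : ∀ a s', leafScore a₀ ℓ b (⟨s, a, τ h s a s', s'⟩ :: h) = leafScore a₀ ℓ b h :=
      fun a s' => leafScore_cons_of_not_mem hmem
    simp only [hX, expect_add, expect_const]
    gcongr
    have hval : ∀ a, expect ((treeMDP S H p hp a₀ a₁ ℓ b).P s a)
        (fun s' => treeGain q r ℓ b (idx s')) =
        (if a = a₀ then
          p * treeGain q r ℓ b (treeChild ℓ b (Fintype.card S) (idx s) 0) else 0) +
        if a = a₁ then
          p * treeGain q r ℓ b (treeChild ℓ b (Fintype.card S) (idx s) 1) else 0 := by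
      intro a
      simp only [treeMDP, twoPointMDP]
      rw [expect_twoPoint, hdump, mul_zero, add_zero]
      by_cases ha : a = a₀
      · have ha' : a ≠ a₁ := fun h => hne (ha.symm.trans h)
        rw [treeNext, if_pos ha, if_pos ha, if_neg ha', idx_nth (treeChild_lt hℓ hn 0), add_zero]
      · rw [treeNext, if_neg ha, if_neg ha, zero_add]
        split_ifs
        · rw [idx_nth (treeChild_lt hℓ hn 1)]
        · rw [hdump, mul_zero]
    simp only [hval, expect_eq_sum, mul_add, mul_ite, mul_zero, Finset.sum_add_distrib,
      Finset.sum_ite_eq', Finset.mem_univ, if_true]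
    refine le_trans (le_of_eq ?_) (treeGain_step (n := Fintype.card S) (β₀ := β a₀) (β₁ := β a₁)
      hℓ ((mul_le_mul_right (behavior_le L hε _ _ _) p).trans hq)
      ((mul_le_mul_right (behavior_add_le L hε _ _ hne) p).trans hr) hs)
    ring

open Classical in
/-- The probability that a leaf is visited in the first episode is at most `1 / 2`, since its first
step has to be an exploration step. -/
lemma expect_visits_treeLeaves_le {H : ℕ} {p : ℝ≥0∞} (hp : p ≤ 1) {a₀ a₁ : A} {ℓ b : ℕ}
    (hℓ : 1 ≤ ℓ) (hn : dumpRoot ℓ b < Fintype.card S) (L : Learner S A)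
    (hε : L.ε / ((Fintype.card A : ℝ) - 1) ≤ 1 / 2)
    {Q₀ : QTable S A} (hQ : ∀ s b, b ≠ a₀ → Q₀ s a₀ < Q₀ s b) (τ : Teacher S A) {n : ℕ}
    (hnH : n < H) :
    expect (historyLaw (treeMDP S H p hp a₀ a₁ ℓ b) L Q₀ τ n)
      (fun h => if Visits (treeLeaves S ℓ b : Set S) h then 1 else 0) ≤ 1 / 2 := by
  set M := treeMDP S H p hp a₀ a₁ ℓ b
  set B : Set S := (treeLeaves S ℓ b : Set S)
  have hℓr : ℓ < dumpRoot ℓ b := by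
    have := Nat.one_lt_two_pow (n := b + 1) (by omega)
    unfold dumpRoot; omega
  -- the potential of all states of the tree is `1` here, whatever their depth
  set G : S → ℝ≥0∞ := fun s => if idx s < dumpRoot ℓ b then 1 else 0
  have hG1 : ∀ s, G s ≤ 1 := fun s => by simp only [G]; split_ifs <;> simp
  have hGd : G (nth S (dumpRoot ℓ b)) = 0 := by simp [G, idx_nth hn]
  have hGnext : ∀ s a, G (treeNext S a₀ a₁ ℓ b s a) ≤ G s := by
    intro s a
    by_cases hs : idx s < dumpRoot ℓ b
    · exact (hG1 _).trans (by simp [G, hs])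
    · rcases treeNext_eq (a₀ := a₀) (a₁ := a₁) (ℓ := ℓ) (b := b) s a with ⟨c, hc, h⟩ | h
      · have := dumpRoot_le_treeChild (n := Fintype.card S) (not_lt.1 hs) c
        simp only [G, h, idx_nth (treeChild_lt hℓ hn c)]
        rw [if_neg (by omega)]
        exact zero_le
      · rw [h, hGd]
        exact zero_le
  have hleaf : ∀ s, IsTreeLeaf ℓ b (idx s) → ∀ a, G (treeNext S a₀ a₁ ℓ b s a) = 0 := by
    intro s hs a
    rcases treeNext_eq (a₀ := a₀) (a₁ := a₁) (ℓ := ℓ) (b := b) s a with ⟨c, hc, h⟩ | h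
    · rw [h, treeChild_of_isTreeLeaf hs, hGd]
    · rw [h, hGd]
  have hd : IsDrift M L Q₀ τ (fun h => if Visits B h then 1 else 0) G := by
    intro h s
    refine (expect_mono _ fun a => ?_).trans (expect_const _ _).le
    by_cases hs : s ∈ B
    · have hs' : IsTreeLeaf ℓ b (idx s) := mem_treeLeaves.1 (Finset.mem_coe.1 hs)
      have hGs : G s = 1 := if_pos hs'.2
      refine expect_twoPoint_le hp ?_ ?_
      · rw [hleaf s hs' a, hGs, add_zero]
        refine le_trans ?_ le_add_self
        dsimp only
        split_ifs <;> simp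
      · rw [hGd, hGs, add_zero]
        refine le_trans ?_ le_add_self
        dsimp only
        split_ifs <;> simp
    · have hv : ∀ s', Visits B (⟨s, a, τ h s a s', s'⟩ :: h) ↔ Visits B h :=
        fun s' => by simp [visits_cons, hs]
      refine expect_twoPoint_le hp ?_ ?_
      · simp only [hv]
        gcongr
        exact hGnext s a
      · simp only [hv, hGd]
        gcongr
        exact zero_le
  rcases n with _ | n
  · simp [historyLaw, expect_pure, Visits]
  · suffices hΨ : (expect (historyLaw M L Q₀ τ (n + 1)) fun h =>
        (if Visits B h then 1 else 0) + expect (currentState M h) G) ≤ 1 / 2 from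
      (expect_mono _ fun h => le_self_add).trans hΨ
    induction n with
    | zero =>
      rw [expect_historyLaw_succ, historyLaw, expect_pure]
      have hroot : currentState M ([] : List (Experience S A)) = PMF.pure (nth S 0) := rfl
      rw [hroot, expect_pure]
      set s := nth S 0
      have hidx : idx s = 0 := idx_nth (by omega)
      have hs : s ∉ B := fun hs => by
        have := (mem_treeLeaves.1 (Finset.mem_coe.1 hs)).1
        have := Nat.one_le_two_pow (n := b)
        omega
      have hcur : ∀ a s', currentState M [(⟨s, a, τ [] s a s', s'⟩ : Experience S A)] =
          PMF.pure s' := by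
        intro a s'
        have : (0 + 1) % M.H ≠ 0 := by
          change (0 + 1) % H ≠ 0
          rw [Nat.mod_eq_of_lt hnH]
          omega
        simp only [currentState, List.length_nil]
        rw [if_neg this]
      have hv : ∀ a s', ¬ Visits B [(⟨s, a, τ [] s a s', s'⟩ : Experience S A)] := by
        intro a s'
        simp [Visits, hs]
      simp only [hcur, expect_pure, hv, if_false, zero_add]
      have hval : ∀ a, expect (M.P s a) G ≤ if a = a₀ then 1 else 0 := by
        intro a
        split_ifs with ha
        · exact expect_twoPoint_le hp (hG1 _) (hG1 _)
        · refine expect_twoPoint_le hp (le_of_eq ?_) hGd.le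
          have hc : treeChild ℓ b (Fintype.card S) (idx s) 1 = dumpRoot ℓ b := by
            rw [treeChild, if_pos (by omega), if_neg one_ne_zero]
          rw [treeNext, if_neg ha, hc, ite_self, hGd]
      refine (expect_mono _ hval).trans ?_
      rw [expect_eq_sum]
      simp only [mul_ite, mul_one, mul_zero, Finset.sum_ite_eq', Finset.mem_univ, if_true]
      have hgr : a₀ ≠ L.greedy (L.table Q₀ []) s := by
        intro h
        obtain ⟨a, ha⟩ := exists_ne a₀
        have := L.greedy_max (L.table Q₀ []) s a
        rw [← h] at this
        exact absurd (hQ s a ha) (not_lt.2 this)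
      rw [behavior_of_ne_greedy _ _ _ _ hgr]
      refine (ENNReal.ofReal_le_ofReal hε).trans (le_of_eq ?_)
      rw [ENNReal.ofReal_div_of_pos two_pos]
      simp
    | succ n ih =>
      refine (hd.expect_succ_le (n + 1)).trans ?_
      have : ¬ M.H ∣ n + 1 + 1 := fun h => absurd (Nat.le_of_dvd (by omega) h) (not_le.2 hnH)
      rw [if_neg this, add_zero]
      exact ih (by omega)

/-- The expected teaching length on the tree MDP, where `G` bounds the expected progress of an
episode: about `H / G` steps per unit of progress, and not less than half an episode. -/
lemma le_expectedLength_treeMDP {H : ℕ} {p : ℝ≥0∞} (hp : p ≤ 1) {a₀ a₁ : A} (hne : a₀ ≠ a₁)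
    {ℓ b : ℕ} (hℓ : 1 ≤ ℓ) (hn : dumpRoot ℓ b < Fintype.card S) (L : Learner S A)
    (hε : L.ε / ((Fintype.card A : ℝ) - 1) ≤ 1 - L.ε)
    {Q₀ : QTable S A} (hQ : ∀ s b, b ≠ a₀ → Q₀ s a₀ < Q₀ s b) (τ : Teacher S A) {G : ℝ≥0∞}
    (hG : (p * ENNReal.ofReal (1 - L.ε)) ^ ℓ * (2 * (p * (ENNReal.ofReal (1 - L.ε) +
      ENNReal.ofReal (L.ε / ((Fintype.card A : ℝ) - 1)))) ^ b) ≤ G)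
    (hG0 : G ≠ 0) (hGtop : G ≠ ⊤) :
    (H : ℝ≥0∞) * (((2 ^ b * (Fintype.card A - 1) : ℕ) : ℝ≥0∞) / (2 * G)) / 4 ≤
      expectedLength (treeMDP S H p hp a₀ a₁ ℓ b) L Q₀ (fun _ => a₀) τ := by
  classical
  have hA : 1 < Fintype.card A := Fintype.one_lt_card
  set X : ℕ := 2 ^ b * (Fintype.card A - 1) with hX
  have hXpos : 0 < X := Nat.mul_pos (by positivity) (by omega)
  have hscore : ∀ s (h h' : List (Experience S A)), h' <:+ h →
      Taught (fun _ => a₀) (L.table Q₀ h') → Fintype.card A - 1 ≤ score a₀ s h := by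
    intro s h h' hs ht
    have hmax : ∀ a, L.table Q₀ h' s a ≤ L.table Q₀ h' s a₀ := by
      intro a
      by_cases ha : a = a₀
      · rw [ha]
      · exact (ht s a ha).le
    exact (score_eq_of_isMax (hQ s) hmax).ge.trans (score_mono hs)
  -- the bound from the total progress that is needed
  have hlong : ∀ m : ℕ, (m : ℝ≥0∞) * (2 * G) ≤ X → ((H * m : ℕ) : ℝ≥0∞) / 2 ≤
      expectedLength (treeMDP S H p hp a₀ a₁ ℓ b) L Q₀ (fun _ => a₀) τ := by
    intro m hm
    refine le_expectedLength _ _ _ _ _ _ fun n hnm => ?_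
    refine le_probNotDone _ _ _ _ _ (leafScore a₀ ℓ b) X ?_ n ?_
      (by exact_mod_cast hXpos.ne') (ENNReal.natCast_ne_top X)
    · intro h h' hs ht
      rw [leafScore, ← Nat.cast_sum]
      have : (treeLeaves S ℓ b).card * (Fintype.card A - 1) ≤
          ∑ s ∈ treeLeaves S ℓ b, score a₀ s h := by
        rw [← smul_eq_mul]
        exact Finset.card_nsmul_le_sum _ _ _ fun s _ => hscore s h h' hs ht
      exact_mod_cast (Nat.mul_le_mul_right _ (le_card_treeLeaves hn)).trans this
    · have hb := (leafScore_isDrift (H := H) hp hne hℓ hn L (ENNReal.ofReal_le_ofReal hε) hQ τ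
        le_rfl le_rfl).expect_le (by simp [leafScore, score_nil]) n
      have hroot : expect (treeMDP S H p hp a₀ a₁ ℓ b).μ₀ (fun s =>
          treeGain (p * ENNReal.ofReal (1 - L.ε)) (p * (ENNReal.ofReal (1 - L.ε) +
            ENNReal.ofReal (L.ε / ((Fintype.card A : ℝ) - 1)))) ℓ b (idx s)) ≤ G := by
        refine le_trans (le_of_eq ?_) hG
        rw [show (treeMDP S H p hp a₀ a₁ ℓ b).μ₀ = PMF.pure (nth S 0) from rfl, expect_pure,
          idx_nth (by omega), treeGain, if_pos (by unfold dumpRoot; omega),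
          Nat.sub_eq_zero_of_le (Nat.zero_le ℓ)]
        simp
      have hmn : 1 + n / H ≤ m := by
        have := Nat.div_lt_of_lt_mul hnm
        omega
      calc _ ≤ 2 * (G * (m : ℝ≥0∞)) := by
            refine mul_le_mul_right (hb.trans (mul_le_mul' hroot ?_)) 2
            exact_mod_cast hmn
        _ = (m : ℝ≥0∞) * (2 * G) := by ring
        _ ≤ X := hm
  -- the bound from the first episode
  have hfirst : (H : ℝ≥0∞) / 2 ≤
      expectedLength (treeMDP S H p hp a₀ a₁ ℓ b) L Q₀ (fun _ => a₀) τ := by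
    refine le_expectedLength _ _ _ _ _ _ fun n hnH => ?_
    refine le_probNotDone _ _ _ _ _
      (fun h => if Visits (treeLeaves S ℓ b : Set S) h then 1 else 0) 1 ?_ n ?_
      one_ne_zero ENNReal.one_ne_top
    · intro h h' hs ht
      have hpos : 0 < (treeLeaves S ℓ b).card :=
        lt_of_lt_of_le (by positivity) (le_card_treeLeaves hn)
      obtain ⟨s, hsl⟩ := Finset.card_pos.1 hpos
      obtain ⟨a, ha⟩ := exists_ne a₀
      obtain ⟨e, he, hes⟩ := visits_of_taught (target := fun _ => a₀) ha (hQ s a ha).le ht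
      rw [if_pos]
      exact Visits.mono hs ⟨e, he, by rw [Set.mem_singleton_iff.1 hes]; exact hsl⟩
    · have hε' : L.ε / ((Fintype.card A : ℝ) - 1) ≤ 1 / 2 := by
        -- `x ≤ 1 - ε` and `x ≤ ε`, where `x = ε / (|A| - 1)`
        have h2 : (2 : ℝ) ≤ Fintype.card A := by exact_mod_cast hA
        have := div_le_self L.ε_nonneg (by linarith : (1 : ℝ) ≤ (Fintype.card A : ℝ) - 1)
        linarith
      have := expect_visits_treeLeaves_le (H := H) (a₁ := a₁) hp hℓ hn L hε' hQ τ hnH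
      calc _ ≤ (2 : ℝ≥0∞) * (1 / 2) := mul_le_mul_right this 2
        _ = 1 := by rw [one_div]; exact ENNReal.mul_inv_cancel (by simp) (by simp)
  -- `max 1 ⌊y⌋ ≥ y / 2`
  set y : ℝ≥0∞ := (X : ℝ≥0∞) / (2 * G) with hy
  have h2G : 2 * G ≠ 0 := by simp [hG0]
  have h2Gt : 2 * G ≠ ⊤ := ENNReal.mul_ne_top (by simp) hGtop
  have hytop : y ≠ ⊤ := ENNReal.div_ne_top (ENNReal.natCast_ne_top X) h2G
  set m : ℕ := ⌊y.toReal⌋₊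
  have hm1 : (m : ℝ≥0∞) ≤ y := by
    rw [← ENNReal.ofReal_toReal hytop, ← ENNReal.ofReal_natCast]
    exact ENNReal.ofReal_le_ofReal (Nat.floor_le ENNReal.toReal_nonneg)
  have hm2 : y ≤ ((m + 1 : ℕ) : ℝ≥0∞) := by
    rw [← ENNReal.ofReal_toReal hytop, ← ENNReal.ofReal_natCast]
    refine ENNReal.ofReal_le_ofReal ?_
    exact_mod_cast (Nat.lt_floor_add_one y.toReal).le
  have hfour : ∀ x : ℝ≥0∞, x * 2 / 4 = x / 2 := by
    intro x
    rw [div_eq_mul_inv, div_eq_mul_inv, mul_assoc, show (4 : ℝ≥0∞) = 2 * 2 by norm_num,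
      ENNReal.mul_inv (by simp) (by simp), ← mul_assoc 2,
      ENNReal.mul_inv_cancel (by simp) (by simp), one_mul]
  rcases Nat.eq_zero_or_pos m with h0 | h0
  · have hy2 : y ≤ 2 := by
      refine hm2.trans ?_
      rw [h0]
      norm_num
    calc _ ≤ (H : ℝ≥0∞) * 2 / 4 := by gcongr
      _ = (H : ℝ≥0∞) / 2 := hfour _
      _ ≤ _ := hfirst
  · have hy2 : y ≤ (m : ℝ≥0∞) * 2 := by
      refine hm2.trans ?_
      exact_mod_cast (by omega : m + 1 ≤ m * 2)
    calc _ ≤ (H : ℝ≥0∞) * ((m : ℝ≥0∞) * 2) / 4 := by gcongr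
      _ = ((H * m : ℕ) : ℝ≥0∞) * 2 / 4 := by push_cast; ring_nf
      _ = ((H * m : ℕ) : ℝ≥0∞) / 2 := hfour _
      _ ≤ _ := hlong m ((ENNReal.le_div_iff_mul_le (Or.inl h2G) (Or.inl h2Gt)).1 hm1)

end Tree

/-! ### The bound for deterministic initial states -/

/-- The branching levels of the tree cost only a constant factor, by `(1 + x) ^ b ≤ exp (b * x)`. -/
lemma add_div_pow_le {ε k : ℝ} {b : ℕ} (h0 : 0 ≤ ε) (h1 : ε < 1) (hk : 0 < k)
    (hb : ε * b ≤ (1 - ε) * k) : ((1 - ε) + ε / k) ^ b ≤ 3 * (1 - ε) ^ b := by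
  have hpos : 0 < 1 - ε := by linarith
  have hfac : (1 - ε) + ε / k = (1 - ε) * (ε / ((1 - ε) * k) + 1) := by
    field_simp
    ring
  have hx0 : 0 ≤ ε / ((1 - ε) * k) := by positivity
  have hexp : (ε / ((1 - ε) * k) + 1) ^ b ≤ 3 := by
    calc (ε / ((1 - ε) * k) + 1) ^ b ≤ Real.exp (ε / ((1 - ε) * k)) ^ b :=
          pow_le_pow_left₀ (by positivity) (Real.add_one_le_exp _) b
      _ = Real.exp (b * (ε / ((1 - ε) * k))) := (Real.exp_nat_mul _ _).symm
      _ ≤ Real.exp 1 := by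
          refine Real.exp_le_exp.2 ?_
          rw [← mul_div_assoc, div_le_one (by positivity)]
          linarith
      _ ≤ 3 := by linarith [Real.exp_one_lt_d9]
  rw [hfac, mul_pow, mul_comm 3]
  exact mul_le_mul_of_nonneg_left hexp (by positivity)

/-- The lower bound for deterministic initial states, with an explicit constant. -/
lemma rate_le_TDim_deterministic {S A : Type} [Fintype S] [Fintype A] [Nontrivial A]
    (L : Learner S A) {H D : ℕ} {p : ℝ≥0∞} (hp : p ≤ 1) (h0 : 0 < p) (h2 : p = 1 ∨ p ≤ 1 / 2)
    (hD : 1 ≤ D) (hS : D + 2 ≤ Fintype.card S) (hS' : Fintype.card S ≤ 2 ^ D + 1)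
    (hε : L.ε * Real.logb 2 ((Fintype.card S : ℝ) - (D : ℝ)) ≤
      (1 - L.ε) * ((Fintype.card A : ℝ) - 1)) :
    ((384⁻¹ : ℝ≥0) : ℝ≥0∞) * rate (Fintype.card S) (Fintype.card A) H D p L.ε ≤
      TDim L {M ∈ mdpFamily S A H D p | ∃ s₀ : S, M.μ₀ = PMF.pure s₀} := by
  classical
  have : Nonempty S := Fintype.card_pos_iff.1 (by omega)
  have hkpos := Learner.card_sub_one_pos (A := A)
  have hA : 1 < Fintype.card A := Fintype.one_lt_card
  obtain ⟨b, hbD, hb1, hb2⟩ := exists_tree_depth hD hS hS'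
  have hpow : b < 2 ^ b := Nat.lt_two_pow_self
  have hpow2 : 2 ^ (b + 1) = 2 * 2 ^ b := by ring
  have hpow4 : 2 ^ (b + 2) = 4 * 2 ^ b := by ring
  have hpowD : 2 ^ (b + 1) ≤ 2 ^ D := Nat.pow_le_pow_right two_pos hbD
  obtain ⟨ℓ, hℓD⟩ : ∃ ℓ, D = ℓ + b := ⟨D - b, by omega⟩
  have hℓ : 1 ≤ ℓ := by omega
  have hn : dumpRoot ℓ b < Fintype.card S := by unfold dumpRoot; omega
  have hn' : Fintype.card S < dumpRoot ℓ b + 2 ^ (ℓ + b) := by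
    rw [← hℓD]; unfold dumpRoot; omega
  -- used for `k = b`, the number of branching levels, and for `k = 1`, which gives `ε < 1`
  have hlog : ∀ k : ℕ, 2 ^ k ≤ Fintype.card S - D →
      (k : ℝ) ≤ Real.logb 2 ((Fintype.card S : ℝ) - (D : ℝ)) := by
    intro k hk
    have hcast : (2 : ℝ) ^ k ≤ (Fintype.card S : ℝ) - (D : ℝ) := by
      rw [← Nat.cast_sub (by omega)]
      exact_mod_cast hk
    rw [Real.le_logb_iff_rpow_le one_lt_two (lt_of_lt_of_le (by positivity) hcast),
      Real.rpow_natCast]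
    exact hcast
  have hεb : L.ε * b ≤ (1 - L.ε) * ((Fintype.card A : ℝ) - 1) :=
    (mul_le_mul_of_nonneg_left (hlog b (by omega)) L.ε_nonneg).trans hε
  have hε1 : L.ε ≤ (1 - L.ε) * ((Fintype.card A : ℝ) - 1) := by
    have := (mul_le_mul_of_nonneg_left (hlog 1 (by omega)) L.ε_nonneg).trans hε
    simpa using this
  have hlt : L.ε < 1 := by
    refine lt_of_le_of_ne L.ε_le_one fun h => ?_
    rw [h] at hε1
    norm_num at hε1
  have hdiv : L.ε / ((Fintype.card A : ℝ) - 1) ≤ 1 - L.ε := by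
    rwa [div_le_iff₀ hkpos]
  set q : ℝ≥0∞ := p * ENNReal.ofReal (1 - L.ε) with hq
  have hq0 : q ≠ 0 := by
    refine mul_ne_zero h0.ne' ?_
    rw [Ne, ENNReal.ofReal_eq_zero]
    linarith
  have hqtop : q ≠ ⊤ :=
    ENNReal.mul_ne_top (ne_top_of_le_ne_top ENNReal.one_ne_top hp) ENNReal.ofReal_ne_top
  have hG : q ^ ℓ * (2 * (p * (ENNReal.ofReal (1 - L.ε) +
      ENNReal.ofReal (L.ε / ((Fintype.card A : ℝ) - 1)))) ^ b) ≤ 6 * q ^ D := by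
    have hpowle : (ENNReal.ofReal (1 - L.ε) +
        ENNReal.ofReal (L.ε / ((Fintype.card A : ℝ) - 1))) ^ b ≤
        3 * ENNReal.ofReal (1 - L.ε) ^ b := by
      rw [← ENNReal.ofReal_add (by linarith) (div_nonneg L.ε_nonneg hkpos.le),
        ← ENNReal.ofReal_pow (add_nonneg (by linarith) (div_nonneg L.ε_nonneg hkpos.le)),
        ← ENNReal.ofReal_pow (by linarith), ← ENNReal.ofReal_ofNat 3,
        ← ENNReal.ofReal_mul (by norm_num)]
      exact ENNReal.ofReal_le_ofReal (add_div_pow_le L.ε_nonneg hlt hkpos hεb)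
    rw [mul_pow p (_ + _) b]
    calc _ ≤ q ^ ℓ * (2 * (p ^ b * (3 * ENNReal.ofReal (1 - L.ε) ^ b))) := by gcongr
      _ = 6 * (q ^ ℓ * (p ^ b * ENNReal.ofReal (1 - L.ε) ^ b)) := by ring
      _ = 6 * q ^ D := by rw [← mul_pow, ← hq, ← pow_add, ← hℓD]
  have hqD : q ^ D ≠ 0 := pow_ne_zero _ hq0
  have hqDtop : q ^ D ≠ ⊤ := ENNReal.pow_ne_top hqtop
  obtain ⟨a₀, a₁, hne⟩ := exists_pair_ne A
  set Q₀ : QTable S A := fun _ a => if a = a₀ then 0 else 1 with hQ₀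
  have hQ : ∀ s b, b ≠ a₀ → Q₀ s a₀ < Q₀ s b := by
    intro s b hb
    simp [hQ₀, hb]
  refine le_iSup_of_le (fun _ => a₀) <| le_iSup_of_le Q₀ <|
    le_iSup_of_le (treeMDP S H p hp a₀ a₁ ℓ b) <| le_iSup_of_le
      ⟨hℓD ▸ treeMDP_mem hp h0 h2 hne hℓ hn hn', nth S 0, rfl⟩ <| le_iInf fun τ => ?_
  refine le_trans ?_ (le_expectedLength_treeMDP hp hne hℓ hn L hdiv hQ τ hG
    (mul_ne_zero (by simp) hqD) (ENNReal.mul_ne_top (by simp) hqDtop))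
  set X : ℕ := 2 ^ b * (Fintype.card A - 1)
  -- `S - D ≤ 4 * 2 ^ b` and `A ≤ 2 * (A - 1)`
  have hX : (Fintype.card S - D) * Fintype.card A ≤ 8 * X := by
    calc (Fintype.card S - D) * Fintype.card A ≤ (4 * 2 ^ b) * (2 * (Fintype.card A - 1)) :=
          Nat.mul_le_mul (by omega) (by omega)
      _ = 8 * X := by ring
  have hconst : ((384⁻¹ : ℝ≥0) : ℝ≥0∞) * 8 = 12⁻¹ * 4⁻¹ := by
    rw [← ENNReal.mul_inv (by simp) (by simp), ENNReal.coe_inv (by norm_num)]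
    have h384 : ((384 : ℝ≥0) : ℝ≥0∞) = (12 * 4) * 8 := by norm_num
    rw [h384, ENNReal.mul_inv (by simp) (by simp), mul_assoc,
      ENNReal.inv_mul_cancel (by simp) (by simp), mul_one]
  rw [rate, ← hq, one_div, ← ENNReal.inv_pow, ← Nat.cast_mul]
  calc ((384⁻¹ : ℝ≥0) : ℝ≥0∞) *
        ((((Fintype.card S - D) * Fintype.card A : ℕ) : ℝ≥0∞) * (H : ℝ≥0∞) * (q ^ D)⁻¹)
      ≤ ((384⁻¹ : ℝ≥0) : ℝ≥0∞) * (((8 * X : ℕ) : ℝ≥0∞) * (H : ℝ≥0∞) * (q ^ D)⁻¹) := by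
        gcongr
    _ = (((384⁻¹ : ℝ≥0) : ℝ≥0∞) * 8) * ((X : ℝ≥0∞) * (H : ℝ≥0∞) * (q ^ D)⁻¹) := by
        push_cast; ring
    _ = (H : ℝ≥0∞) * ((X : ℝ≥0∞) * (12⁻¹ * (q ^ D)⁻¹)) * 4⁻¹ := by rw [hconst]; ring
    _ = (H : ℝ≥0∞) * ((X : ℝ≥0∞) / (2 * (6 * q ^ D))) / 4 := by
        rw [div_eq_mul_inv, div_eq_mul_inv, ← ENNReal.mul_inv (by simp) (by simp), ← mul_assoc 2]
        norm_num

end RLTeaching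

end

theorem theorem5 :
    ∃ c : ℝ≥0, 0 < c ∧
      ∀ (S A : Type) [Fintype S] [Fintype A] [Nontrivial A] (L : RLTeaching.Learner S A)
        (H D : ℕ) (p : ℝ≥0∞),
        D ≤ H →
        D + 2 ≤ Fintype.card S →
        (RLTeaching.mdpFamily S A H D p).Nonempty →
        (c : ℝ≥0∞) * RLTeaching.rate (Fintype.card S) (Fintype.card A) H D p L.ε
            ≤ RLTeaching.TDim L (RLTeaching.mdpFamily S A H D p) ∧
        (1 ≤ D →
          Fintype.card S ≤ 2 ^ D + 1 →
          L.ε * Real.logb 2 ((Fintype.card S : ℝ) - (D : ℝ))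
            ≤ (1 - L.ε) * ((Fintype.card A : ℝ) - 1) →
          (c : ℝ≥0∞) * RLTeaching.rate (Fintype.card S) (Fintype.card A) H D p L.ε
            ≤ RLTeaching.TDim L
                {M ∈ RLTeaching.mdpFamily S A H D p | ∃ s₀ : S, M.μ₀ = PMF.pure s₀}) := by
  refine ⟨384⁻¹, by positivity, fun S A _ _ _ L H D p _ hS hne => ?_⟩
  have : Nonempty S := Fintype.card_pos_iff.1 (by omega)
  obtain ⟨M, -, -, rfl⟩ := hne
  obtain ⟨h0, h2⟩ := M.pMin_pos_and
  have hp : M.pMin ≤ 1 := h2.elim le_of_eq fun h => h.trans (by simp)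
  refine ⟨?_, fun hD hS' hε => RLTeaching.rate_le_TDim_deterministic L hp h0 h2 hD hS hS' hε⟩
  rw [RLTeaching.TDim_eq_top L hp h0 h2 hS]
  exact le_top
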